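/- Let $\mathbb K\in\{\mathbb R,\mathbb C\}$, let $E$ be a Hausdorff topological $\mathbb K$-vector space (not necessarily locally convex), let $F$ be a Hausdorff locally convex topological $\mathbb K$-vector space (no completeness is assumed), let $U\subseteq E$ be open, $f\colon U\to F$ a map and $k\in\mathbb N_0\cup\{\infty\}$. Products carry the product topology. Call $f$ of class $C^0$ if it is continuous. Let $U^{[1]}:=\{(x,v,t)\in U\times E\times\mathbb K : x+tv\in U\}$, an open subset of $E\times E\times\mathbb K$. Call $f$ of class $C^1$ if it is continuous and there is a continuous map $f^{[1]}\colon U^{[1]}\to F$ with $$f(x+tv)-f(x)=t\cdot f^{[1]}(x,v,t)\qquad\text{for all }(x,v,t)\in U^{[1]};$$ the map $f^{[1]}$ is then unique. Inductively, for $n\ge 1$, call $f$ of class $C^{n+1}$ if $f$ is of class $C^1$ and $f^{[1]}$ is of class $C^n$ on $U^{[1]}$. Call $f$ of class $C^\infty$ if it is of class $C^n$ for every $n\in\mathbb N_0$. Call $f$ a $C^k_{MB}$-map ($C^k$ in the sense of Michal–Bastiani, or Keller's $C^k_c$) if $f$ is continuous and, for every integer $j$ with $1\le j\le k$, the iterated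 directional derivatives $$d^jf(x,v_1,\dots,v_j):=\partial_{v_1}\cdots\partial_{v_j}f(x),\qquad \partial_v h(x):=\lim_{0\ne t\to 0,\ t\in\mathbb K}\frac{h(x+tv)-h(x)}{t},$$ exist for all $x\in U$ and $v_1,\dots,v_j\in E$, and the map $d^jf\colon U\times E^j\to F$ so defined is continuous. Then $f$ is of class $C^k$ if and only if $f$ is a $C^k_{MB}$-map. -/

import Mathlib

open Filter Topology

/-! Maps defined on an open set `U ⊆ E` are given as total functions `E → F`, of which only the
restriction to `U` is used. The scalar field is a `Type` (it is `ℝ` or `ℂ`), so that `E × E × 𝕜`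
lives in the same universe as `E`. -/

/-- The set `U^[1] = {(x, v, t) ∈ E × E × 𝕜 : x ∈ U, x + t v ∈ U}`. -/
def diffQuotDomain (𝕜 : Type) {E : Type*} [Add E] [SMul 𝕜 E] (U : Set E) :
    Set (E × E × 𝕜) :=
  {p | p.1 ∈ U ∧ p.1 + p.2.2 • p.2.1 ∈ U}

/-- `g` is the difference quotient map `f^[1]` of `f` on `U`: it is continuous on `U^[1]` and
`f (x + t v) - f x = t g (x, v, t)` for all `(x, v, t) ∈ U^[1]`. For Hausdorff `F` and open `U`
these conditions determine `g` on `U^[1]`. -/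
def IsDiffQuotMap (𝕜 : Type) [RCLike 𝕜] {E F : Type*}
    [AddCommGroup E] [Module 𝕜 E] [TopologicalSpace E]
    [AddCommGroup F] [Module 𝕜 F] [TopologicalSpace F]
    (U : Set E) (f : E → F) (g : E × E × 𝕜 → F) : Prop :=
  ContinuousOn g (diffQuotDomain 𝕜 U) ∧
    ∀ (x v : E) (t : 𝕜), (x, v, t) ∈ diffQuotDomain 𝕜 U →
      f (x + t • v) - f x = t • g (x, v, t)

/-- `f` is of class `C^n` on `U` for `n : ℕ`, in the sense of difference quotient maps:
`C^0` means continuous, and `f` is `C^(n+1)` if it is continuous, has a continuous difference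
quotient map `f^[1] : U^[1] → F`, and `f^[1]` is of class `C^n` on the subset `U^[1]` of
`E × E × 𝕜` (product topology). Unfolding, the maps `f^[0] = f` and `f^[j+1] = (f^[j])^[1]` on
`U^[j+1] = (U^[j])^[1]` exist and are continuous for all orders up to `n`. -/
def IsClassCNat (𝕜 : Type) [RCLike 𝕜] {F : Type*}
    [AddCommGroup F] [Module 𝕜 F] [TopologicalSpace F] :
    (n : ℕ) → (E : Type*) → [AddCommGroup E] → [Module 𝕜 E] → [TopologicalSpace E] →
      Set E → (E → F) → Prop
  | 0, _, _, _, _, U, f => ContinuousOn f U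
  | n + 1, E, _, _, _, U, f =>
      ContinuousOn f U ∧ ∃ g : E × E × 𝕜 → F,
        IsDiffQuotMap 𝕜 U f g ∧
          IsClassCNat 𝕜 n (E × E × 𝕜) (diffQuotDomain 𝕜 U) g

/-- `f` is of class `C^k` on `U`, `k ∈ ℕ ∪ {∞}`. -/
def IsClassC (𝕜 : Type) [RCLike 𝕜] {E F : Type*}
    [AddCommGroup E] [Module 𝕜 E] [TopologicalSpace E]
    [AddCommGroup F] [Module 𝕜 F] [TopologicalSpace F]
    (k : ℕ∞) (U : Set E) (f : E → F) : Prop :=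
  ∀ n : ℕ, (n : ℕ∞) ≤ k → IsClassCNat 𝕜 n E U f

/-- `f` has the directional derivative `y` at `x` in the direction `v`, as a limit over scalars
`t ≠ 0` in `𝕜` tending to `0`. -/
def HasDirDeriv (𝕜 : Type) [RCLike 𝕜] {E F : Type*}
    [AddCommGroup E] [Module 𝕜 E]
    [AddCommGroup F] [Module 𝕜 F] [TopologicalSpace F]
    (f : E → F) (v x : E) (y : F) : Prop :=
  Tendsto (fun t : 𝕜 => t⁻¹ • (f (x + t • v) - f x)) (𝓝[≠] 0) (𝓝 y)

open Classical in
/-- The directional derivative `∂_v f (x)`; it is `0` where the derivative does not exist. -/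
noncomputable def dirDeriv (𝕜 : Type) [RCLike 𝕜] {E F : Type*}
    [AddCommGroup E] [Module 𝕜 E]
    [AddCommGroup F] [Module 𝕜 F] [TopologicalSpace F]
    (v : E) (f : E → F) (x : E) : F :=
  if h : ∃ y, HasDirDeriv 𝕜 f v x y then h.choose else 0

/-- `d^j f (x, v_1, …, v_j) = ∂_{v_1} ⋯ ∂_{v_j} f (x)`, where `v_1, …, v_j` are the entries
`v 0, …, v (j - 1)`; the derivative `∂_{v_1}` is taken last. -/
noncomputable def iterDirDeriv (𝕜 : Type) [RCLike 𝕜] {E F : Type*}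
    [AddCommGroup E] [Module 𝕜 E]
    [AddCommGroup F] [Module 𝕜 F] [TopologicalSpace F]
    (f : E → F) : (j : ℕ) → (Fin j → E) → E → F
  | 0, _ => f
  | j + 1, v => dirDeriv 𝕜 (v 0) (iterDirDeriv 𝕜 f j (Fin.tail v))

/-- `f` is a `C^k`-map on `U` in the sense of Michal–Bastiani (Keller's `C^k_c`), `k ∈ ℕ ∪ {∞}`:
it is continuous and, for all `1 ≤ j ≤ k` (written `j = i + 1`), the iterated directional
derivatives `d^j f (x, v_1, …, v_j)` exist for all `x ∈ U` and `v_1, …, v_j ∈ E` and define a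
continuous map `U × E^j → F`. -/
def IsClassCMB (𝕜 : Type) [RCLike 𝕜] {E F : Type*}
    [AddCommGroup E] [Module 𝕜 E] [TopologicalSpace E]
    [AddCommGroup F] [Module 𝕜 F] [TopologicalSpace F]
    (k : ℕ∞) (U : Set E) (f : E → F) : Prop :=
  ContinuousOn f U ∧ ∀ i : ℕ, ((i + 1 : ℕ) : ℕ∞) ≤ k →
    (∀ x ∈ U, ∀ v : Fin (i + 1) → E,
      ∃ y, HasDirDeriv 𝕜 (iterDirDeriv 𝕜 f i (Fin.tail v)) (v 0) x y) ∧
    ContinuousOn (fun p : E × (Fin (i + 1) → E) => iterDirDeriv 𝕜 f (i + 1) p.2 p.1)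
      (U ×ˢ Set.univ)

/-! The two notions of differentiability are compared through a third one, `IsDirC`: the map
`df : (x, v) ↦ ∂_v f (x)` exists on `U × E` and is again of this kind, one order lower, now as a
function of points and directions together.

* A map of class `C^n` satisfies `IsDirC` because `df (x, v) = f^[1] (x, v, 0)`
  (`IsClassCNat.isDirC`).
* The converse amounts to showing that `f^[1]` loses only one order. For `t ≠ 0` it is the quotient
  `t⁻¹ (f (x + t v) - f x)`, and near `t = 0` it is the integral `∫₀¹ df (x + s t v, v) ds`. Integrals
  of this shape are stable under differentiation: the derivative of `p ↦ ∫₀¹ s^m h (α p + s σ p) ds`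
  is a sum of two integrals of the same shape, formed with `dh` in place of `h`
  (`hasDirDeriv_segmentMoment`). They are therefore as regular as `h` (`IsDirC.segmentMoment_comp`,
  `IsDirC.diffQuot_of_pi`).
* The integrals are taken in a product of Banach spaces into which the locally convex space `F`
  embeds (`WithSeminorms.isInducing_toCompletion`). As `F` need not be complete, it has to be checked
  that the derivatives of `f^[1]` lie in `F`. For `t ≠ 0` they come from the derivatives of `f`. At
  `t = 0` the curve of integration is constant, so the integrands of all derivatives are polynomials
  in `s` with coefficients in `F`. The set `Z` and the submodule `S` in `IsDirC` keep track of this,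
  and `IsDirC.diffQuot_of_locallyConvex` is the result for `F`.
* Finally, the iterated directional derivatives `d^j f` are derivatives in the sense of `IsDirC` with
  the directions kept fixed (`IsDirC.uncurry_iterDirDeriv`). Conversely, if the `d^j f` exist and are
  continuous, they are multilinear in the directions, and then the derivative of `d^j f` in all its
  variables is a combination of values of `d^(j+1) f` and `d^j f`
  (`HasContIterDirDeriv.isDirC_iterDirDeriv`). -/

universe u

/-! ### Directional derivatives -/

section DirDeriv

variable {𝕜 : Type} [RCLike 𝕜]
  {E : Type*} [AddCommGroup E] [Module 𝕜 E] {E' : Type*} [AddCommGroup E'] [Module 𝕜 E']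
  {F : Type*} [AddCommGroup F] [Module 𝕜 F] [TopologicalSpace F]
  {G : Type*} [AddCommGroup G] [Module 𝕜 G] [TopologicalSpace G]

theorem tendsto_add_smul_zero [TopologicalSpace E] [IsTopologicalAddGroup E]
    [ContinuousSMul 𝕜 E] (x v : E) :
    Tendsto (fun t : 𝕜 => x + t • v) (𝓝[≠] 0) (𝓝 x) := by
  have h : Continuous fun t : 𝕜 => x + t • v := by fun_prop
  simpa using (h.tendsto 0).mono_left nhdsWithin_le_nhds

theorem HasDirDeriv.congr_of_eqOn [TopologicalSpace E] [IsTopologicalAddGroup E]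
    [ContinuousSMul 𝕜 E] {f g : E → F} {U : Set E} (hU : IsOpen U) {x v : E} {y : F}
    (h : HasDirDeriv 𝕜 f v x y) (hx : x ∈ U) (hfg : Set.EqOn f g U) : HasDirDeriv 𝕜 g v x y := by
  refine Tendsto.congr' ?_ h
  filter_upwards [(tendsto_add_smul_zero x v).eventually (hU.mem_nhds hx)] with t ht
  rw [hfg ht, hfg hx]

theorem HasDirDeriv.unique [T2Space F] {f : E' → F} {x v : E'} {y z : F}
    (h : HasDirDeriv 𝕜 f v x y) (h' : HasDirDeriv 𝕜 f v x z) : y = z :=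
  tendsto_nhds_unique h h'

theorem HasDirDeriv.dirDeriv_eq [T2Space F] {f : E' → F} {x v : E'} {y : F}
    (h : HasDirDeriv 𝕜 f v x y) : dirDeriv 𝕜 v f x = y := by
  have hex : ∃ y, HasDirDeriv 𝕜 f v x y := ⟨y, h⟩
  rw [dirDeriv, dif_pos hex]
  exact hex.choose_spec.unique h

theorem hasDirDeriv_dirDeriv {f : E' → F} {x v : E'}
    (h : ∃ y, HasDirDeriv 𝕜 f v x y) : HasDirDeriv 𝕜 f v x (dirDeriv 𝕜 v f x) := by
  rw [dirDeriv, dif_pos h]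
  exact h.choose_spec

/-- A function with a directional derivative is continuous along the corresponding line. -/
theorem HasDirDeriv.tendsto [IsTopologicalAddGroup F] [ContinuousSMul 𝕜 F]
    {f : E' → F} {x v : E'} {y : F} (h : HasDirDeriv 𝕜 f v x y) :
    Tendsto (fun t : 𝕜 => f (x + t • v)) (𝓝[≠] 0) (𝓝 (f x)) := by
  have ht : Tendsto (fun t : 𝕜 => t) (𝓝[≠] 0) (𝓝 0) := nhdsWithin_le_nhds
  have h1 := (ht.smul h).const_add (f x)
  rw [zero_smul, add_zero] at h1
  refine h1.congr' ?_
  filter_upwards [self_mem_nhdsWithin] with t ht0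
  rw [smul_inv_smul₀ ht0]
  abel

theorem HasDirDeriv.add [IsTopologicalAddGroup F] {f g : E' → F} {x v : E'} {y z : F}
    (hf : HasDirDeriv 𝕜 f v x y) (hg : HasDirDeriv 𝕜 g v x z) :
    HasDirDeriv 𝕜 (fun x => f x + g x) v x (y + z) := by
  refine (Tendsto.add hf hg).congr fun t => ?_
  rw [← smul_add, add_sub_add_comm]

theorem HasDirDeriv.smul [IsTopologicalAddGroup F] [ContinuousSMul 𝕜 F]
    {a : E' → 𝕜} {f : E' → F} {x v : E'} {b : 𝕜} {y : F}
    (ha : HasDirDeriv 𝕜 a v x b) (hf : HasDirDeriv 𝕜 f v x y) :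
    HasDirDeriv 𝕜 (fun x => a x • f x) v x (b • f x + a x • y) := by
  refine ((Tendsto.smul ha hf.tendsto).add (Tendsto.const_smul hf (a x))).congr fun t => ?_
  rw [smul_eq_mul, mul_smul, ← smul_comm (t⁻¹) (a x), ← smul_add]
  congr 1
  rw [sub_smul, smul_sub]
  abel

theorem HasDirDeriv.inv {a : E' → 𝕜} {x v : E'} {b : 𝕜}
    (ha : HasDirDeriv 𝕜 a v x b) (h0 : a x ≠ 0) :
    HasDirDeriv 𝕜 (fun x => (a x)⁻¹) v x (-b * ((a x)⁻¹ * (a x)⁻¹)) := by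
  have h1 := ha.tendsto
  have h2 := (Tendsto.neg ha).mul ((h1.inv₀ h0).mul_const ((a x)⁻¹))
  refine h2.congr' ?_
  filter_upwards [h1.eventually (isOpen_ne.mem_nhds h0)] with t ht
  simp only [smul_eq_mul]
  field_simp
  ring

theorem HasDirDeriv.prodMk {f : E' → F} {g : E' → G} {x v : E'} {y : F} {z : G}
    (hf : HasDirDeriv 𝕜 f v x y) (hg : HasDirDeriv 𝕜 g v x z) :
    HasDirDeriv 𝕜 (fun x => (f x, g x)) v x (y, z) :=
  Tendsto.prodMk_nhds hf hg

theorem HasDirDeriv.clm_comp {f : E' → F} {x v : E'} {y : F} (hf : HasDirDeriv 𝕜 f v x y)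
    (L : F →L[𝕜] G) : HasDirDeriv 𝕜 (fun x => L (f x)) v x (L y) := by
  refine ((L.continuous.tendsto y).comp hf).congr fun t => ?_
  simp

theorem HasDirDeriv.comp_linearMap {f : E' → F} (L : E →ₗ[𝕜] E') {x v : E} {y : F}
    (hf : HasDirDeriv 𝕜 f (L v) (L x) y) : HasDirDeriv 𝕜 (fun x => f (L x)) v x y := by
  refine hf.congr fun t => ?_
  simp

theorem HasDirDeriv.smul_dir [IsTopologicalAddGroup F] [ContinuousSMul 𝕜 F]
    {f : E' → F} {x v : E'} {y : F} (hf : HasDirDeriv 𝕜 f v x y) (c : 𝕜) :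
    HasDirDeriv 𝕜 f (c • v) x (c • y) := by
  rcases eq_or_ne c 0 with rfl | hc
  · simpa [HasDirDeriv] using tendsto_const_nhds
  · have h : Tendsto (fun t : 𝕜 => t * c) (𝓝[≠] 0) (𝓝[≠] 0) := by
      refine tendsto_nhdsWithin_iff.2 ⟨?_, ?_⟩
      · have h : Continuous fun t : 𝕜 => t * c := by fun_prop
        simpa using (h.tendsto 0).mono_left nhdsWithin_le_nhds
      · filter_upwards [self_mem_nhdsWithin] with t ht using mul_ne_zero ht hc
    refine ((Tendsto.comp hf h).const_smul c).congr fun t => ?_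
    simp only [Function.comp, mul_inv, smul_smul]
    rw [mul_comm (t⁻¹), mul_inv_cancel_left₀ hc]

end DirDeriv

/-! ### Iterated differentiability through the derivative on points and directions -/

/-- `f` is `n` times directionally differentiable on `U` with continuous derivatives, where the
derivative of `f` is the map `df : (x, v) ↦ ∂_v f (x)` on `U × E` and higher derivatives are those of
`df` (so directions are differentiated as well). Moreover `f` and its derivatives of order at most
`n` take values in the submodule `S` over the points of `Z`.

For `S` the image of `F` in a complete space, the condition on `Z` records that the derivatives
live in `F`; for `S = ⊤` it is void. -/
def IsDirC {𝕜 : Type} [RCLike 𝕜] {F : Type*}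
    [AddCommGroup F] [Module 𝕜 F] [TopologicalSpace F] (S : Submodule 𝕜 F) :
    (n : ℕ) → (E : Type*) → [AddCommGroup E] → [Module 𝕜 E] → [TopologicalSpace E] →
      (U Z : Set E) → (E → F) → Prop
  | 0, _, _, _, _, U, Z, f => ContinuousOn f U ∧ Set.MapsTo f Z S
  | n + 1, E, _, _, _, U, Z, f =>
      ContinuousOn f U ∧ Set.MapsTo f Z S ∧ ∃ df : E × E → F,
        (∀ x ∈ U, ∀ v, HasDirDeriv 𝕜 f v x (df (x, v))) ∧
          IsDirC S n (E × E) (U ×ˢ Set.univ) (Z ×ˢ Set.univ) df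

namespace IsDirC

variable {𝕜 : Type} [RCLike 𝕜] {F : Type*} [AddCommGroup F] [Module 𝕜 F] [TopologicalSpace F]
  {G : Type*} [AddCommGroup G] [Module 𝕜 G] [TopologicalSpace G]
  {S : Submodule 𝕜 F}

section Basic

variable {E : Type u} [AddCommGroup E] [Module 𝕜 E] [TopologicalSpace E]

theorem continuousOn {n : ℕ} {U Z : Set E} {f : E → F} (h : IsDirC S n E U Z f) :
    ContinuousOn f U := by
  cases n <;> exact h.1

theorem mapsTo {n : ℕ} {U Z : Set E} {f : E → F} (h : IsDirC S n E U Z f) :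
    Set.MapsTo f Z S := by
  cases n
  · exact h.2
  · exact h.2.1

theorem congr [IsTopologicalAddGroup E] [ContinuousSMul 𝕜 E] {n : ℕ} {U Z : Set E} {f g : E → F}
    (h : IsDirC S n E U Z f) (hU : IsOpen U) (hZ : Z ⊆ U) (hfg : Set.EqOn f g U) :
    IsDirC S n E U Z g := by
  have hc : ContinuousOn g U := h.continuousOn.congr hfg.symm
  have hm : Set.MapsTo g Z S := h.mapsTo.congr (hfg.mono hZ)
  cases n with
  | zero => exact ⟨hc, hm⟩
  | succ n =>
    obtain ⟨-, -, df, hd, hdf⟩ := h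
    exact ⟨hc, hm, df, fun x hx v => (hd x hx v).congr_of_eqOn hU hx hfg, hdf⟩

end Basic

theorem mono {n : ℕ} : ∀ {E : Type u} [AddCommGroup E] [Module 𝕜 E] [TopologicalSpace E]
    {U U' Z Z' : Set E} {f : E → F}, IsDirC S n E U Z f → U' ⊆ U → Z' ⊆ Z →
    IsDirC S n E U' Z' f := by
  induction n with
  | zero => exact fun h hU hZ => ⟨h.1.mono hU, h.2.mono_left hZ⟩
  | succ n ih =>
    rintro E _ _ _ U U' Z Z' f ⟨hc, hm, df, hd, hdf⟩ hU hZ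
    exact ⟨hc.mono hU, hm.mono_left hZ, df, fun x hx => hd x (hU hx),
      ih hdf (Set.prod_mono_left hU) (Set.prod_mono_left hZ)⟩

theorem of_succ {n : ℕ} : ∀ {E : Type u} [AddCommGroup E] [Module 𝕜 E] [TopologicalSpace E]
    {U Z : Set E} {f : E → F}, IsDirC S (n + 1) E U Z f → IsDirC S n E U Z f := by
  induction n with
  | zero => exact fun h => ⟨h.1, h.2.1⟩
  | succ n ih =>
    rintro E _ _ _ U Z f ⟨hc, hm, df, hd, hdf⟩
    exact ⟨hc, hm, df, hd, ih hdf⟩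

theorem of_le {n m : ℕ} (hnm : m ≤ n) {E : Type u} [AddCommGroup E] [Module 𝕜 E]
    [TopologicalSpace E] {U Z : Set E} {f : E → F} (h : IsDirC S n E U Z f) :
    IsDirC S m E U Z f := by
  induction n, hnm using Nat.le_induction with
  | base => exact h
  | succ n _ ih => exact ih h.of_succ

theorem comp_clm {n : ℕ} : ∀ {E E' : Type u} [AddCommGroup E] [Module 𝕜 E] [TopologicalSpace E]
    [AddCommGroup E'] [Module 𝕜 E'] [TopologicalSpace E'] {U Z : Set E} {f : E → F},
    IsDirC S n E U Z f → ∀ L : E' →L[𝕜] E,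
    IsDirC S n E' (L ⁻¹' U) (L ⁻¹' Z) (fun x => f (L x)) := by
  induction n with
  | zero =>
    intro E E' _ _ _ _ _ _ U Z f h L
    exact ⟨h.1.comp L.continuous.continuousOn (Set.mapsTo_preimage L U), fun x hx => h.2 hx⟩
  | succ n ih =>
    rintro E E' _ _ _ _ _ _ U Z f ⟨hc, hm, df, hd, hdf⟩ L
    refine ⟨hc.comp L.continuous.continuousOn (Set.mapsTo_preimage L U), fun x hx => hm hx,
      fun p => df (L p.1, L p.2), fun x hx v => (hd (L x) hx (L v)).comp_linearMap L.toLinearMap, ?_⟩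
    exact (ih hdf (L.prodMap L)).mono (fun p hp => ⟨hp.1, trivial⟩) (fun p hp => ⟨hp.1, trivial⟩)

theorem clm_comp {n : ℕ} {T : Submodule 𝕜 G} (L : F →L[𝕜] G)
    (hL : ∀ y ∈ S, L y ∈ T) : ∀ {E : Type u} [AddCommGroup E] [Module 𝕜 E] [TopologicalSpace E]
    {U Z : Set E} {f : E → F}, IsDirC S n E U Z f → IsDirC T n E U Z (fun x => L (f x)) := by
  induction n with
  | zero => exact fun h => ⟨L.continuous.comp_continuousOn h.1, fun x hx => hL _ (h.2 hx)⟩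
  | succ n ih =>
    rintro E _ _ _ U Z f ⟨hc, hm, df, hd, hdf⟩
    exact ⟨L.continuous.comp_continuousOn hc, fun x hx => hL _ (hm hx), fun p => L (df p),
      fun x hx v => (hd x hx v).clm_comp L, ih hdf⟩

theorem zero {n : ℕ} [IsTopologicalAddGroup F] : ∀ {E : Type u} [AddCommGroup E] [Module 𝕜 E]
    [TopologicalSpace E] {U Z : Set E}, IsDirC S n E U Z (fun _ => (0 : F)) := by
  induction n with
  | zero => exact ⟨continuousOn_const, fun _ _ => S.zero_mem⟩
  | succ n ih =>
    intro E _ _ _ U Z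
    exact ⟨continuousOn_const, fun _ _ => S.zero_mem, fun _ => 0,
      fun x _ v => by simpa [HasDirDeriv] using tendsto_const_nhds, ih⟩

/-- Continuous linear maps are smooth. -/
theorem clm {n : ℕ} [IsTopologicalAddGroup F] {E : Type u} [AddCommGroup E] [Module 𝕜 E]
    [TopologicalSpace E] {U Z : Set E} (L : E →L[𝕜] F) :
    IsDirC (⊤ : Submodule 𝕜 F) n E U Z L := by
  induction n generalizing E with
  | zero => exact ⟨L.continuous.continuousOn, fun _ _ => trivial⟩
  | succ n ih =>
    refine ⟨L.continuous.continuousOn, fun _ _ => trivial, fun p => L p.2, fun x _ v => ?_,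
      ih (L.comp (ContinuousLinearMap.snd 𝕜 E E))⟩
    refine tendsto_const_nhds.congr' ?_
    filter_upwards [self_mem_nhdsWithin] with t ht
    simp [inv_smul_smul₀ ht]

theorem add {n : ℕ} [IsTopologicalAddGroup F] : ∀ {E : Type u} [AddCommGroup E] [Module 𝕜 E]
    [TopologicalSpace E] {U Z : Set E} {f g : E → F}, IsDirC S n E U Z f → IsDirC S n E U Z g →
    IsDirC S n E U Z (fun x => f x + g x) := by
  induction n with
  | zero => exact fun hf hg => ⟨hf.1.add hg.1, fun x hx => S.add_mem (hf.2 hx) (hg.2 hx)⟩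
  | succ n ih =>
    rintro E _ _ _ U Z f g ⟨hc, hm, df, hd, hdf⟩ ⟨hc', hm', dg, hd', hdg⟩
    exact ⟨hc.add hc', fun x hx => S.add_mem (hm hx) (hm' hx), fun p => df p + dg p,
      fun x hx v => (hd x hx v).add (hd' x hx v), ih hdf hdg⟩

theorem sum {n : ℕ} [IsTopologicalAddGroup F] {E : Type u} [AddCommGroup E] [Module 𝕜 E]
    [TopologicalSpace E] {U Z : Set E} {ι : Type*} (s : Finset ι) {f : ι → E → F}
    (h : ∀ i ∈ s, IsDirC S n E U Z (f i)) : IsDirC S n E U Z (fun x => ∑ i ∈ s, f i x) := by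
  classical
  induction s using Finset.induction_on with
  | empty => simpa using zero
  | insert i s hi ih =>
    simp only [Finset.sum_insert hi]
    exact (h i (Finset.mem_insert_self i s)).add
      (ih fun j hj => h j (Finset.mem_insert_of_mem hj))

theorem prodMk {n : ℕ} : ∀ {E : Type u} [AddCommGroup E] [Module 𝕜 E]
    [TopologicalSpace E] {U Z : Set E} {f : E → F} {g : E → G},
    IsDirC (⊤ : Submodule 𝕜 F) n E U Z f → IsDirC (⊤ : Submodule 𝕜 G) n E U Z g →
    IsDirC (⊤ : Submodule 𝕜 (F × G)) n E U Z (fun x => (f x, g x)) := by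
  induction n with
  | zero => exact fun hf hg => ⟨hf.1.prodMk hg.1, fun x hx => trivial⟩
  | succ n ih =>
    rintro E _ _ _ U Z f g ⟨hc, hm, df, hd, hdf⟩ ⟨hc', hm', dg, hd', hdg⟩
    exact ⟨hc.prodMk hc', fun x hx => trivial, fun p => (df p, dg p),
      fun x hx v => (hd x hx v).prodMk (hd' x hx v), ih hdf hdg⟩

theorem comp_fst {n : ℕ} {E : Type u} [AddCommGroup E] [Module 𝕜 E] [TopologicalSpace E]
    {U Z : Set E} {f : E → F} (h : IsDirC S n E U Z f) :
    IsDirC S n (E × E) (U ×ˢ Set.univ) (Z ×ˢ Set.univ) (fun p => f p.1) :=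
  (h.comp_clm (ContinuousLinearMap.fst 𝕜 E E)).mono (fun _ hp => hp.1) (fun _ hp => hp.1)

theorem smul {n : ℕ} [IsTopologicalAddGroup F] [ContinuousSMul 𝕜 F] :
    ∀ {E : Type u} [AddCommGroup E] [Module 𝕜 E]
    [TopologicalSpace E] {U Z : Set E} {a : E → 𝕜} {f : E → F},
    IsDirC (⊤ : Submodule 𝕜 𝕜) n E U Z a → IsDirC S n E U Z f →
    IsDirC S n E U Z (fun x => a x • f x) := by
  induction n with
  | zero => exact fun ha hf => ⟨ha.1.smul hf.1, fun x hx => S.smul_mem _ (hf.2 hx)⟩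
  | succ n ih =>
    intro E _ _ _ U Z a f ha hf
    have ha' := ha.of_succ.comp_fst
    have hf' := hf.of_succ.comp_fst
    obtain ⟨hc, hm, da, hd, hda⟩ := ha
    obtain ⟨hc', hm', df, hd', hdf⟩ := hf
    exact ⟨hc.smul hc', fun x hx => S.smul_mem _ (hm' hx),
      fun p => da p • f p.1 + a p.1 • df p,
      fun x hx v => (hd x hx v).smul (hd' x hx v), (ih hda hf').add (ih ha' hdf)⟩

theorem inv {n : ℕ} :
    ∀ {E : Type u} [AddCommGroup E] [Module 𝕜 E] [TopologicalSpace E]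
    {U Z : Set E} {a : E → 𝕜}, IsDirC (⊤ : Submodule 𝕜 𝕜) n E U Z a → (∀ x ∈ U, a x ≠ 0) →
    IsDirC (⊤ : Submodule 𝕜 𝕜) n E U Z (fun x => (a x)⁻¹) := by
  induction n with
  | zero => exact fun ha h0 => ⟨ha.1.inv₀ h0, fun x hx => trivial⟩
  | succ n ih =>
    intro E _ _ _ U Z a ha h0
    have ha' := (ih ha.of_succ h0).comp_fst
    obtain ⟨hc, hm, da, hd, hda⟩ := ha
    refine ⟨hc.inv₀ h0, fun x hx => trivial,
      fun p => -da p * ((a p.1)⁻¹ * (a p.1)⁻¹), fun x hx v => (hd x hx v).inv (h0 x hx), ?_⟩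
    exact (hda.clm_comp (T := ⊤) (-ContinuousLinearMap.id 𝕜 𝕜) fun _ _ => trivial).smul
      (ha'.smul ha')

/-- The property is local; it even suffices that near each `x` the values and derivatives at `x`
itself are known to lie in `S`. -/
theorem of_locally {n : ℕ} [T2Space F] : ∀ {E : Type u} [AddCommGroup E] [Module 𝕜 E]
    [TopologicalSpace E] [IsTopologicalAddGroup E] [ContinuousSMul 𝕜 E] {U : Set E} {f : E → F},
    (∀ x ∈ U, ∃ U', IsOpen U' ∧ x ∈ U' ∧ IsDirC S n E U' {x} f) → IsDirC S n E U U f := by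
  induction n with
  | zero =>
    intro E _ _ _ _ _ U f h
    refine ⟨fun x hx => ?_, fun x hx => ?_⟩ <;> obtain ⟨U', hU', hxU', hc, hm⟩ := h x hx
    · exact (hc.continuousAt (hU'.mem_nhds hxU')).continuousWithinAt
    · exact hm rfl
  | succ n ih =>
    intro E _ _ _ _ _ U f h
    refine ⟨fun x hx => ?_, fun x hx => ?_, fun p => dirDeriv 𝕜 p.2 f p.1, fun x hx v => ?_, ?_⟩
    · obtain ⟨U', hU', hxU', hc, hm⟩ := h x hx
      exact (hc.continuousAt (hU'.mem_nhds hxU')).continuousWithinAt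
    · obtain ⟨U', hU', hxU', hc, hm, -⟩ := h x hx
      exact hm rfl
    · obtain ⟨U', hU', hxU', hc, hm, df, hd, -⟩ := h x hx
      exact hasDirDeriv_dirDeriv ⟨_, hd x hxU' v⟩
    · have := ih (U := U ×ˢ Set.univ) (f := fun p : E × E => dirDeriv 𝕜 p.2 f p.1) ?_
      · exact this
      rintro ⟨x, v⟩ ⟨hx, -⟩
      obtain ⟨U', hU', hxU', hc, hm, df, hd, hdf⟩ := h x hx
      refine ⟨U' ×ˢ Set.univ, hU'.prod isOpen_univ, ⟨hxU', trivial⟩, ?_⟩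
      have := hdf.congr (g := fun p : E × E => dirDeriv 𝕜 p.2 f p.1) (hU'.prod isOpen_univ)
        (Set.prod_mono_left (Set.singleton_subset_iff.2 hxU'))
        fun p hp => (hd p.1 hp.1 p.2).dirDeriv_eq.symm
      exact this.mono subset_rfl (by simp)

/-- If `F` is embedded into `G` by `ι`, then derivatives of `ι ∘ f` with values in the image of `F`
are derivatives of `f`. -/
theorem of_isInducing_comp {n : ℕ} {ι : F →L[𝕜] G} (hι : IsInducing ι) :
    ∀ {E : Type u} [AddCommGroup E] [Module 𝕜 E] [TopologicalSpace E]
    [IsTopologicalAddGroup E] [ContinuousSMul 𝕜 E] {U : Set E} {f : E → F}, IsOpen U →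
    IsDirC ι.range n E U U (fun x => ι (f x)) → IsDirC (⊤ : Submodule 𝕜 F) n E U U f := by
  induction n with
  | zero =>
    intro E _ _ _ _ _ U f hU h
    exact ⟨hι.continuousOn_iff.2 h.1, fun _ _ => trivial⟩
  | succ n ih =>
    rintro E _ _ _ _ _ U f hU ⟨hc, -, df, hd, hdf⟩
    refine ⟨hι.continuousOn_iff.2 hc, fun _ _ => trivial, Function.invFun ι ∘ df, ?_, ?_⟩
    · intro x hx v
      have hy : ι (Function.invFun ι (df (x, v))) = df (x, v) :=
        Function.invFun_eq (LinearMap.mem_range.1 (hdf.mapsTo (x := (x, v)) ⟨hx, trivial⟩))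
      have h := hd x hx v
      rw [← hy] at h
      refine hι.tendsto_nhds_iff.2 (h.congr fun t => ?_)
      simp
    · refine ih (hU.prod isOpen_univ) (hdf.congr (hU.prod isOpen_univ) subset_rfl fun p hp => ?_)
      exact (Function.invFun_eq (LinearMap.mem_range.1 (hdf.mapsTo hp))).symm

end IsDirC

/-! ### Difference quotient maps -/

section DiffQuot

open Classical in
/-- The map `f^[1]` built from `f` and a candidate `df` for its derivative: the difference quotient
`t⁻¹ (f (x + t v) - f x)` for `t ≠ 0`, and `df (x, v)` for `t = 0`. -/
noncomputable def diffQuot {𝕜 : Type} [RCLike 𝕜] {E F : Type*} [AddCommGroup E] [Module 𝕜 E]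
    [AddCommGroup F] [Module 𝕜 F] (f : E → F) (df : E × E → F) (p : E × E × 𝕜) : F :=
  if p.2.2 = 0 then df (p.1, p.2.1) else p.2.2⁻¹ • (f (p.1 + p.2.2 • p.2.1) - f p.1)

variable {𝕜 : Type} [RCLike 𝕜]
  {E : Type*} [AddCommGroup E] [Module 𝕜 E]
  {F : Type*} [AddCommGroup F] [Module 𝕜 F]

theorem diffQuot_zero (f : E → F) (df : E × E → F) (x v : E) :
    diffQuot f df (x, v, (0 : 𝕜)) = df (x, v) := if_pos rfl

theorem diffQuot_of_ne (f : E → F) (df : E × E → F) (x v : E) {t : 𝕜} (ht : t ≠ 0) :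
    diffQuot f df (x, v, t) = t⁻¹ • (f (x + t • v) - f x) := if_neg ht

theorem smul_diffQuot (f : E → F) (df : E × E → F) (x v : E) (t : 𝕜) :
    t • diffQuot f df (x, v, t) = f (x + t • v) - f x := by
  rcases eq_or_ne t 0 with rfl | ht
  · simp
  · rw [diffQuot_of_ne _ _ _ _ ht, smul_inv_smul₀ ht]

variable [TopologicalSpace E] [IsTopologicalAddGroup E] [ContinuousSMul 𝕜 E]
  [TopologicalSpace F] [IsTopologicalAddGroup F]

theorem isOpen_diffQuotDomain {U : Set E} (hU : IsOpen U) : IsOpen (diffQuotDomain 𝕜 U) :=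
  (hU.preimage continuous_fst).inter
    (hU.preimage (f := fun p : E × E × 𝕜 => p.1 + p.2.2 • p.2.1) (by fun_prop))

/-- If `f` has a continuous difference quotient map, its derivative is additive in the
direction. -/
theorem map_add_of_continuousOn_diffQuot [T2Space F] {U : Set E} (hU : IsOpen U) {f : E → F}
    {df : E × E → F} (hd : ∀ x ∈ U, ∀ v, HasDirDeriv 𝕜 f v x (df (x, v)))
    (hc : ContinuousOn (diffQuot (𝕜 := 𝕜) f df) (diffQuotDomain 𝕜 U))
    {x : E} (hx : x ∈ U) (v w : E) : df (x, v + w) = df (x, v) + df (x, w) := by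
  have hmem : ((x, w, 0) : E × E × 𝕜) ∈ diffQuotDomain 𝕜 U := by simpa [diffQuotDomain]
  have h1 := (hc.continuousAt ((isOpen_diffQuotDomain hU).mem_nhds hmem)).tendsto
  have h2 : Tendsto (fun r : 𝕜 => (x + r • v, w, r)) (𝓝[≠] 0) (𝓝 (x, w, 0)) :=
    (tendsto_add_smul_zero x v).prodMk_nhds (tendsto_const_nhds.prodMk_nhds nhdsWithin_le_nhds)
  have h3 := Tendsto.add (hd x hx v) (h1.comp h2)
  rw [diffQuot_zero] at h3
  refine tendsto_nhds_unique (Tendsto.congr' ?_ (hd x hx (v + w))) h3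
  filter_upwards [self_mem_nhdsWithin] with r hr
  rw [Function.comp, diffQuot_of_ne _ _ _ _ hr, ← smul_add, smul_add r, ← add_assoc]
  congr 1
  abel

end DiffQuot

/-! ### Integrals along segments -/

section Moment

variable {X : Type*} [TopologicalSpace X] {A : Type*} [NormedAddCommGroup A] [NormedSpace ℝ A]

/-- Integrals over a compact interval depend continuously on a parameter in an arbitrary
topological space (which need not be first countable). -/
theorem continuousOn_integral_of_continuousOn_prod {H : X → ℝ → A} {Y : Set X}
    (hH : ContinuousOn (Function.uncurry H) (Y ×ˢ Set.Icc 0 1)) :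
    ContinuousOn (fun x => ∫ s in (0 : ℝ)..1, H x s) Y := by
  have hint : ∀ x ∈ Y, IntervalIntegrable (H x) MeasureTheory.volume 0 1 := fun x hx =>
    ContinuousOn.intervalIntegrable_of_Icc zero_le_one
      (hH.comp (by fun_prop : Continuous fun s : ℝ => (x, s)).continuousOn fun s hs => ⟨hx, hs⟩)
  intro x₀ hx₀
  refine Metric.tendsto_nhds.2 fun ε hε => ?_
  obtain ⟨v, hv, hv'⟩ := isCompact_Icc.mem_uniformity_of_prod hH hx₀
    (Metric.dist_mem_uniformity (half_pos hε))
  filter_upwards [hv, self_mem_nhdsWithin] with x hx hxY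
  rw [dist_eq_norm, ← intervalIntegral.integral_sub (hint x hxY) (hint x₀ hx₀)]
  refine (intervalIntegral.norm_integral_le_of_norm_le_const (C := ε / 2) fun s hs => ?_).trans_lt
    (by simpa using half_lt_self hε)
  rw [Set.uIoc_of_le zero_le_one] at hs
  rw [← dist_eq_norm]
  exact (hv' x hx s ⟨hs.1.le, hs.2⟩).le

variable (𝕜 : Type) [RCLike 𝕜]
  {E : Type*} [AddCommGroup E] [Module 𝕜 E]
  {I : Type*} {B : I → Type*} [∀ i, NormedAddCommGroup (B i)] [∀ i, NormedSpace 𝕜 (B i)]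
  [∀ i, NormedSpace ℝ (B i)]

/-- The set of pairs `(a, b)` such that the segment from `a` to `a + b` lies in `V`. -/
def segmentSet (V : Set E) : Set (E × E) :=
  {p | ∀ s ∈ Set.Icc (0 : ℝ) 1, p.1 + (s : 𝕜) • p.2 ∈ V}

/-- The moment `∫₀¹ s ^ m h (a + s b) ds` of `h` along the segment from `a` to `a + b`, for `h` with
values in a product of normed spaces; the integral is taken in each factor. -/
noncomputable def segmentMoment (m : ℕ) (h : E → ∀ i, B i) (p : E × E) : ∀ i, B i :=
  fun i => ∫ s in (0 : ℝ)..1, (s : 𝕜) ^ m • h (p.1 + (s : 𝕜) • p.2) i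

variable [TopologicalSpace E] [IsTopologicalAddGroup E] [ContinuousSMul 𝕜 E]

variable {𝕜}

theorem isOpen_segmentSet {V : Set E} (hV : IsOpen V) : IsOpen (segmentSet 𝕜 V) := by
  refine isOpen_iff_mem_nhds.2 fun p hp => ?_
  refine isCompact_Icc.eventually_forall_of_forall_eventually
    (P := fun (p : E × E) (s : ℝ) => p.1 + (s : 𝕜) • p.2 ∈ V) fun s hs => ?_
  have h : Continuous fun z : (E × E) × ℝ => z.1.1 + (z.2 : 𝕜) • z.1.2 := by fun_prop
  exact h.continuousAt.eventually (hV.mem_nhds (hp s hs))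

omit [∀ i, NormedSpace ℝ (B i)] in
theorem continuousOn_segmentIntegrand (m : ℕ) {h : E → ∀ i, B i} {V : Set E}
    (hh : ContinuousOn h V) (i : I) :
    ContinuousOn (Function.uncurry fun (p : E × E) (s : ℝ) =>
      (s : 𝕜) ^ m • h (p.1 + (s : 𝕜) • p.2) i) (segmentSet 𝕜 V ×ˢ Set.Icc 0 1) := by
  refine ContinuousOn.smul (by fun_prop) ?_
  refine (continuous_apply i).comp_continuousOn (hh.comp (f := fun z : (E × E) × ℝ =>
    z.1.1 + (z.2 : 𝕜) • z.1.2) (by fun_prop) fun z hz => hz.1 _ hz.2)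

omit [∀ i, NormedSpace ℝ (B i)] in
theorem intervalIntegrable_segmentIntegrand (m : ℕ) {h : E → ∀ i, B i} {V : Set E}
    (hh : ContinuousOn h V) {p : E × E} (hp : p ∈ segmentSet 𝕜 V) (i : I) :
    IntervalIntegrable (fun s : ℝ => (s : 𝕜) ^ m • h (p.1 + (s : 𝕜) • p.2) i)
      MeasureTheory.volume 0 1 :=
  ContinuousOn.intervalIntegrable_of_Icc zero_le_one
    ((continuousOn_segmentIntegrand m hh i).comp
      (by fun_prop : Continuous fun s : ℝ => (p, s)).continuousOn fun s hs => ⟨hp, hs⟩)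

theorem continuousOn_segmentMoment (m : ℕ) {h : E → ∀ i, B i} {V : Set E}
    (hh : ContinuousOn h V) : ContinuousOn (segmentMoment 𝕜 m h) (segmentSet 𝕜 V) :=
  continuousOn_pi.2 fun i =>
    continuousOn_integral_of_continuousOn_prod (continuousOn_segmentIntegrand m hh i)

omit [TopologicalSpace E] [IsTopologicalAddGroup E] [ContinuousSMul 𝕜 E] in
theorem segmentMoment_const [∀ i, CompleteSpace (B i)] (m : ℕ) (h : E → ∀ i, B i) (a : E) :
    segmentMoment 𝕜 m h (a, 0) = (∫ s in (0 : ℝ)..1, (s : 𝕜) ^ m) • h a := by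
  ext i
  simp only [segmentMoment, smul_zero, add_zero, Pi.smul_apply]
  exact intervalIntegral.integral_smul_const _ _

omit [TopologicalSpace E] [IsTopologicalAddGroup E] [ContinuousSMul 𝕜 E] in
theorem segmentMoment_zero_const [∀ i, CompleteSpace (B i)] (h : E → ∀ i, B i) (a : E) :
    segmentMoment 𝕜 0 h (a, 0) = h a := by
  rw [segmentMoment_const]
  simp

/-- Fundamental theorem of calculus along a segment. -/
theorem sub_eq_smul_segmentMoment [∀ i, CompleteSpace (B i)] {U : Set E} {f : E → ∀ i, B i}
    {df : E × E → ∀ i, B i} (hd : ∀ x ∈ U, ∀ v, HasDirDeriv 𝕜 f v x (df (x, v)))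
    (hc : ContinuousOn df (U ×ˢ Set.univ)) {x v : E} {t : 𝕜}
    (hp : (x, t • v) ∈ segmentSet 𝕜 U) :
    f (x + t • v) - f x = t • segmentMoment 𝕜 0 df ((x, v), (t • v, 0)) := by
  have hp' : ((x, v), (t • v, (0 : E))) ∈ segmentSet 𝕜 (U ×ˢ (Set.univ : Set E)) :=
    fun s hs => ⟨hp s hs, trivial⟩
  ext i
  have hint := intervalIntegrable_segmentIntegrand 0 hc hp' i
  simp only [pow_zero, one_smul, Prod.mk_add_mk, Prod.smul_mk, smul_zero, add_zero] at hint
  have hderiv : ∀ s ∈ Set.uIcc (0 : ℝ) 1,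
      HasDerivAt (fun s : ℝ => f (x + (s : 𝕜) • t • v) i)
        (t • df (x + (s : 𝕜) • t • v, v) i) s := by
    intro s hs
    rw [Set.uIcc_of_le zero_le_one] at hs
    have h1 := tendsto_pi_nhds.1 ((hd _ (hp s hs) v).smul_dir t) i
    have h2 : Tendsto (fun r : ℝ => (r : 𝕜)) (𝓝[≠] 0) (𝓝[≠] 0) := by
      refine tendsto_nhdsWithin_iff.2 ⟨?_, ?_⟩
      · have h : Continuous fun r : ℝ => (r : 𝕜) := RCLike.continuous_ofReal
        simpa using (h.tendsto 0).mono_left nhdsWithin_le_nhds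
      · filter_upwards [self_mem_nhdsWithin] with r hr using by simpa using hr
    rw [hasDerivAt_iff_tendsto_slope_zero]
    refine (h1.comp h2).congr fun r => ?_
    simp only [Function.comp, Pi.smul_apply, Pi.sub_apply]
    rw [RCLike.ofReal_add, add_smul, ← add_assoc, ← RCLike.ofReal_inv, algebraMap_smul 𝕜]
  have h := intervalIntegral.integral_eq_sub_of_hasDerivAt hderiv (hint.smul t)
  rw [intervalIntegral.integral_smul] at h
  simpa [segmentMoment] using h.symm

/-- Near points with `t = 0` the difference quotient map is an integral of the derivative. -/
theorem diffQuot_eq_segmentMoment [∀ i, CompleteSpace (B i)] {U : Set E} {f : E → ∀ i, B i}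
    {df : E × E → ∀ i, B i} (hd : ∀ x ∈ U, ∀ v, HasDirDeriv 𝕜 f v x (df (x, v)))
    (hc : ContinuousOn df (U ×ˢ Set.univ)) {x v : E} {t : 𝕜}
    (hp : (x, t • v) ∈ segmentSet 𝕜 U) :
    diffQuot f df (x, v, t) = segmentMoment 𝕜 0 df ((x, v), (t • v, 0)) := by
  rcases eq_or_ne t 0 with rfl | ht
  · rw [diffQuot_zero, zero_smul]
    exact (segmentMoment_zero_const df (x, v)).symm
  · rw [diffQuot_of_ne _ _ _ _ ht, sub_eq_smul_segmentMoment hd hc hp, inv_smul_smul₀ ht]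

/-- Once the derivative of `f` is continuous, so is its difference quotient map; at `t = 0` this
follows from the integral formula. -/
theorem continuousOn_diffQuot [∀ i, CompleteSpace (B i)] {U : Set E} (hU : IsOpen U)
    {f : E → ∀ i, B i} {df : E × E → ∀ i, B i} (hf : ContinuousOn f U)
    (hd : ∀ x ∈ U, ∀ v, HasDirDeriv 𝕜 f v x (df (x, v)))
    (hc : ContinuousOn df (U ×ˢ Set.univ)) :
    ContinuousOn (diffQuot (𝕜 := 𝕜) f df) (diffQuotDomain 𝕜 U) := by
  rintro ⟨x, v, t⟩ ⟨hx, hxt⟩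
  refine ContinuousAt.continuousWithinAt ?_
  rcases eq_or_ne t 0 with rfl | ht
  · have hev : ∀ᶠ p : E × E × 𝕜 in 𝓝 (x, v, 0), (p.1, p.2.2 • p.2.1) ∈ segmentSet 𝕜 U := by
      have h : Continuous fun p : E × E × 𝕜 => (p.1, p.2.2 • p.2.1) := by fun_prop
      refine h.continuousAt.eventually ((isOpen_segmentSet hU).mem_nhds ?_)
      simpa [segmentSet] using fun _ _ _ => hx
    have hmem : ((x, v), ((0 : 𝕜) • v, (0 : E))) ∈ segmentSet 𝕜 (U ×ˢ (Set.univ : Set E)) := by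
      simpa [segmentSet] using fun _ _ _ => hx
    have h1 := (continuousOn_segmentMoment 0 hc).continuousAt
      ((isOpen_segmentSet (hU.prod isOpen_univ)).mem_nhds hmem)
    have h2 : Continuous fun p : E × E × 𝕜 => ((p.1, p.2.1), (p.2.2 • p.2.1, (0 : E))) := by
      fun_prop
    refine (ContinuousAt.comp (x := ((x, v, 0) : E × E × 𝕜)) h1 h2.continuousAt).congr ?_
    filter_upwards [hev] with p hp using (diffQuot_eq_segmentMoment hd hc hp).symm
  · have h1 : ContinuousAt (fun p : E × E × 𝕜 => p.2.2⁻¹ • (f (p.1 + p.2.2 • p.2.1) - f p.1))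
        (x, v, t) := by
      have h2 : ContinuousAt (fun p : E × E × 𝕜 => f (p.1 + p.2.2 • p.2.1)) (x, v, t) :=
        ContinuousAt.comp (x := ((x, v, t) : E × E × 𝕜)) (g := f)
          (f := fun p : E × E × 𝕜 => p.1 + p.2.2 • p.2.1)
          (hf.continuousAt (hU.mem_nhds hxt)) (by fun_prop)
      have h3 : ContinuousAt (fun p : E × E × 𝕜 => f p.1) (x, v, t) :=
        ContinuousAt.comp (x := ((x, v, t) : E × E × 𝕜)) (g := f)
          (f := fun p : E × E × 𝕜 => p.1)
          (hf.continuousAt (hU.mem_nhds hx)) (by fun_prop)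
      have h4 : ContinuousAt (fun p : E × E × 𝕜 => p.2.2⁻¹) (x, v, t) :=
        ContinuousAt.inv₀ (by fun_prop) ht
      exact h4.smul (h2.sub h3)
    refine h1.congr ?_
    have h5 : ∀ᶠ p : E × E × 𝕜 in 𝓝 (x, v, t), p.2.2 ≠ 0 :=
      (by fun_prop : Continuous fun p : E × E × 𝕜 => p.2.2).continuousAt.eventually_ne ht
    filter_upwards [h5] with p hp using (diffQuot_of_ne f df p.1 p.2.1 hp).symm

/-- Differentiation under the integral sign: the derivative of `p ↦ ∫₀¹ s ^ m h (α p + s σ p) ds`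
is `∫₀¹ s ^ m dh (α p + s σ p, dα) ds + ∫₀¹ s ^ (m + 1) dh (α p + s σ p, dσ) ds`. -/
theorem hasDirDeriv_segmentMoment [∀ i, CompleteSpace (B i)]
    {P : Type*} [AddCommGroup P] [Module 𝕜 P] [TopologicalSpace P]
    [IsTopologicalAddGroup P] [ContinuousSMul 𝕜 P]
    (m : ℕ) {V : Set E} (hV : IsOpen V) {h : E → ∀ i, B i}
    {dh : E × E → ∀ i, B i} (hh : ContinuousOn h V)
    (hd : ∀ x ∈ V, ∀ v, HasDirDeriv 𝕜 h v x (dh (x, v)))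
    (hc : ContinuousOn dh (V ×ˢ Set.univ)) {W : Set P} (hW : IsOpen W) {α σ : P → E}
    (hVW : ∀ p ∈ W, (α p, σ p) ∈ segmentSet 𝕜 V) {p q : P} (hp : p ∈ W) {a b : E}
    (ha : HasDirDeriv 𝕜 α q p a) (hb : HasDirDeriv 𝕜 σ q p b) :
    HasDirDeriv 𝕜 (fun p => segmentMoment 𝕜 m h (α p, σ p)) q p
      (segmentMoment 𝕜 m dh ((α p, a), (σ p, 0)) +
        segmentMoment 𝕜 (m + 1) dh ((α p, b), (σ p, 0))) := by
  have hh1 := continuousOn_diffQuot hV hh hd hc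
  have hmem : ((α p, a, 0), (σ p, b, 0)) ∈ segmentSet 𝕜 (diffQuotDomain 𝕜 V) := by
    intro s hs
    have := hVW p hp s hs
    simpa [diffQuotDomain]
  -- The difference quotient of the integral is the integral of the difference quotient of `h`.
  have h1 := ((continuousOn_segmentMoment m hh1).continuousAt
    ((isOpen_segmentSet (isOpen_diffQuotDomain hV)).mem_nhds hmem)).tendsto
  have h2 : Tendsto (fun r : 𝕜 => (((α p, r⁻¹ • (α (p + r • q) - α p), r),
      (σ p, r⁻¹ • (σ (p + r • q) - σ p), 0)) : (E × E × 𝕜) × (E × E × 𝕜))) (𝓝[≠] 0)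
      (𝓝 ((α p, a, 0), (σ p, b, 0))) :=
    (tendsto_const_nhds.prodMk_nhds (ha.prodMk_nhds nhdsWithin_le_nhds)).prodMk_nhds
      (tendsto_const_nhds.prodMk_nhds (hb.prodMk_nhds tendsto_const_nhds))
  have hval : segmentMoment 𝕜 m (diffQuot (𝕜 := 𝕜) h dh) ((α p, a, 0), (σ p, b, 0)) =
      segmentMoment 𝕜 m dh ((α p, a), (σ p, 0)) +
        segmentMoment 𝕜 (m + 1) dh ((α p, b), (σ p, 0)) := by
    ext i
    have hmem' : ∀ c : E, ((α p, c), (σ p, (0 : E))) ∈ segmentSet 𝕜 (V ×ˢ (Set.univ : Set E)) :=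
      fun c s hs => ⟨hVW p hp s hs, trivial⟩
    simp only [segmentMoment, Pi.add_apply]
    rw [← intervalIntegral.integral_add
      (intervalIntegrable_segmentIntegrand m hc (hmem' a) i)
      (intervalIntegrable_segmentIntegrand (m + 1) hc (hmem' b) i)]
    refine intervalIntegral.integral_congr fun s hs => ?_
    rw [Set.uIcc_of_le zero_le_one] at hs
    have hs' := hVW p hp s hs
    simp only [Prod.mk_add_mk, Prod.smul_mk, smul_zero, add_zero, diffQuot_zero]
    rw [map_add_of_continuousOn_diffQuot hV hd hh1 hs',
      (hd _ hs' ((s : 𝕜) • b)).unique ((hd _ hs' b).smul_dir _), Pi.add_apply, Pi.smul_apply,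
      smul_add, smul_smul, pow_succ]
  rw [hval] at h1
  refine Tendsto.congr' ?_ (h1.comp h2)
  filter_upwards [self_mem_nhdsWithin,
    (tendsto_add_smul_zero p q).eventually (hW.mem_nhds hp)] with r hr hrW
  ext i
  simp only [Function.comp, segmentMoment, Pi.smul_apply, Pi.sub_apply]
  rw [← intervalIntegral.integral_sub
      (intervalIntegrable_segmentIntegrand m hh (hVW _ hrW) i)
      (intervalIntegrable_segmentIntegrand m hh (hVW _ hp) i),
    ← intervalIntegral.integral_smul]
  refine intervalIntegral.integral_congr fun s hs => ?_
  simp only [Prod.mk_add_mk, Prod.smul_mk, smul_zero, add_zero]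
  rw [diffQuot_of_ne _ _ _ _ hr, Pi.smul_apply, Pi.sub_apply, smul_comm, smul_sub ((s : 𝕜) ^ m)]
  have : α p + (s : 𝕜) • σ p + r • (r⁻¹ • (α (p + r • q) - α p) +
      (s : 𝕜) • r⁻¹ • (σ (p + r • q) - σ p)) = α (p + r • q) + (s : 𝕜) • σ (p + r • q) := by
    rw [smul_comm (s : 𝕜), smul_add, smul_inv_smul₀ hr, smul_inv_smul₀ hr, smul_sub]
    abel
  rw [this]

end Moment

/-! ### Regularity of difference quotient maps -/

namespace IsDirC

variable {𝕜 : Type} [RCLike 𝕜]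
  {I : Type*} {B : I → Type*} [∀ i, NormedAddCommGroup (B i)] [∀ i, NormedSpace 𝕜 (B i)]
  [∀ i, NormedSpace ℝ (B i)] [∀ i, CompleteSpace (B i)] {S : Submodule 𝕜 (∀ i, B i)}

/-- Moments `∫₀¹ s ^ m h (α p + s σ p) ds` inherit the regularity of `h`. At points with `σ p = 0`
the integrands of all derivatives are monomials in `s` with coefficients among the derivatives of
`h`, so that the derivatives of the moment stay in `S`. -/
theorem segmentMoment_comp {n : ℕ} : ∀ {E P : Type u}
    [AddCommGroup E] [Module 𝕜 E] [TopologicalSpace E] [IsTopologicalAddGroup E]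
    [ContinuousSMul 𝕜 E] [AddCommGroup P] [Module 𝕜 P] [TopologicalSpace P]
    [IsTopologicalAddGroup P] [ContinuousSMul 𝕜 P]
    (m : ℕ) {V : Set E} {h : E → ∀ i, B i} {W : Set P} {α σ : P → E},
    IsOpen V → IsOpen W → IsDirC S n E V V h →
    IsDirC (⊤ : Submodule 𝕜 E) n P W W α → IsDirC (⊤ : Submodule 𝕜 E) n P W W σ →
    (∀ p ∈ W, (α p, σ p) ∈ segmentSet 𝕜 V) →
    IsDirC S n P W {p | p ∈ W ∧ σ p = 0} (fun p => segmentMoment 𝕜 m h (α p, σ p)) := by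
  have hS : ∀ {E P : Type u} [AddCommGroup E] [Module 𝕜 E] (m : ℕ) {V : Set E}
      {h : E → ∀ i, B i} {W : Set P} {α σ : P → E}, Set.MapsTo h V S →
      (∀ p ∈ W, (α p, σ p) ∈ segmentSet 𝕜 V) →
      Set.MapsTo (fun p => segmentMoment 𝕜 m h (α p, σ p)) {p | p ∈ W ∧ σ p = 0} S := by
    intro E P _ _ m V h W α σ hm hVW p hp
    have h0 := hVW p hp.1 0 (by simp)
    simp only [RCLike.ofReal_zero, zero_smul, add_zero] at h0
    simp only [hp.2, segmentMoment_const]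
    exact S.smul_mem _ (hm h0)
  have hC : ∀ {E P : Type u} [AddCommGroup E] [Module 𝕜 E] [TopologicalSpace E]
      [IsTopologicalAddGroup E] [ContinuousSMul 𝕜 E] [TopologicalSpace P]
      (m : ℕ) {V : Set E} {h : E → ∀ i, B i} {W : Set P} {α σ : P → E}, ContinuousOn h V →
      ContinuousOn α W → ContinuousOn σ W → (∀ p ∈ W, (α p, σ p) ∈ segmentSet 𝕜 V) →
      ContinuousOn (fun p => segmentMoment 𝕜 m h (α p, σ p)) W := by
    intro E P _ _ _ _ _ _ m V h W α σ hh hα hσ hVW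
    exact (continuousOn_segmentMoment m hh).comp (hα.prodMk hσ) hVW
  induction n with
  | zero =>
    intro E P _ _ _ _ _ _ _ _ _ _ m V h W α σ hV hW hh hα hσ hVW
    exact ⟨hC m hh.1 hα.1 hσ.1 hVW, hS m hh.2 hVW⟩
  | succ n ih =>
    intro E P _ _ _ _ _ _ _ _ _ _ m V h W α σ hV hW hh hα hσ hVW
    have hα' := hα.of_succ.comp_fst
    have hσ' := hσ.of_succ.comp_fst
    obtain ⟨hhc, hhm, dh, hhd, hdh⟩ := hh
    obtain ⟨hαc, -, dα, hαd, hdα⟩ := hα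
    obtain ⟨hσc, -, dσ, hσd, hdσ⟩ := hσ
    refine ⟨hC m hhc hαc hσc hVW, hS m hhm hVW,
      fun z => segmentMoment 𝕜 m dh ((α z.1, dα z), (σ z.1, 0)) +
        segmentMoment 𝕜 (m + 1) dh ((α z.1, dσ z), (σ z.1, 0)),
      fun p hp q => hasDirDeriv_segmentMoment m hV hhc hhd hdh.continuousOn hW hVW hp
        (hαd p hp q) (hσd p hp q), ?_⟩
    have hmem : ∀ c : P × P → E, ∀ z ∈ W ×ˢ (Set.univ : Set P),
        ((α z.1, c z), (σ z.1, (0 : E))) ∈ segmentSet 𝕜 (V ×ˢ (Set.univ : Set E)) :=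
      fun c z hz s hs => ⟨hVW z.1 hz.1 s hs, trivial⟩
    have hz : ∀ z ∈ {p | p ∈ W ∧ σ p = 0} ×ˢ (Set.univ : Set P),
        z ∈ {z : P × P | z ∈ W ×ˢ (Set.univ : Set P) ∧ (σ z.1, (0 : E)) = 0} :=
      fun z hz => ⟨⟨hz.1.1, trivial⟩, by simp [hz.1.2]⟩
    exact ((ih m (hV.prod isOpen_univ) (hW.prod isOpen_univ) hdh (hα'.prodMk hdα)
        (hσ'.prodMk zero) (hmem _)).mono subset_rfl hz).add
      ((ih (m + 1) (hV.prod isOpen_univ) (hW.prod isOpen_univ) hdh (hα'.prodMk hdσ)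
        (hσ'.prodMk zero) (hmem _)).mono subset_rfl hz)

/-- The difference quotient map of a map of order `n + 1` is of order `n`: near `t = 0` it is an
integral of the derivative, and for `t ≠ 0` it is a quotient. -/
theorem diffQuot_of_pi {n : ℕ} {E : Type u} [AddCommGroup E] [Module 𝕜 E] [TopologicalSpace E]
    [IsTopologicalAddGroup E] [ContinuousSMul 𝕜 E] {U : Set E} (hU : IsOpen U)
    {f : E → ∀ i, B i} {df : E × E → ∀ i, B i} (hf : IsDirC S n E U U f)
    (hd : ∀ x ∈ U, ∀ v, HasDirDeriv 𝕜 f v x (df (x, v)))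
    (hdf : IsDirC S n (E × E) (U ×ˢ Set.univ) (U ×ˢ Set.univ) df) :
    IsDirC S n (E × E × 𝕜) (diffQuotDomain 𝕜 U) (diffQuotDomain 𝕜 U)
      (diffQuot f df) := by
  -- The coordinates of `(x, v, t)` and the map `t v` are smooth.
  have hx : ∀ W : Set (E × E × 𝕜), IsDirC (⊤ : Submodule 𝕜 E) n _ W W fun p => p.1 :=
    fun W => clm (ContinuousLinearMap.fst 𝕜 E (E × 𝕜))
  have hv : ∀ W : Set (E × E × 𝕜), IsDirC (⊤ : Submodule 𝕜 E) n _ W W fun p => p.2.1 :=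
    fun W => clm ((ContinuousLinearMap.fst 𝕜 E 𝕜).comp (ContinuousLinearMap.snd 𝕜 E (E × 𝕜)))
  have ht : ∀ W : Set (E × E × 𝕜), IsDirC (⊤ : Submodule 𝕜 𝕜) n _ W W fun p => p.2.2 :=
    fun W => clm ((ContinuousLinearMap.snd 𝕜 E 𝕜).comp (ContinuousLinearMap.snd 𝕜 E (E × 𝕜)))
  have htv : ∀ W : Set (E × E × 𝕜), IsDirC (⊤ : Submodule 𝕜 E) n _ W W fun p => p.2.2 • p.2.1 :=
    fun W => (ht W).smul (hv W)
  refine of_locally ?_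
  rintro ⟨x, v, t⟩ ⟨hxU, hxt⟩
  rcases eq_or_ne t 0 with rfl | ht0
  · have hW : IsOpen {p : E × E × 𝕜 | (p.1, p.2.2 • p.2.1) ∈ segmentSet 𝕜 U} :=
      (isOpen_segmentSet hU).preimage
        (f := fun p : E × E × 𝕜 => (p.1, p.2.2 • p.2.1)) (by fun_prop)
    refine ⟨_, hW, by simpa [segmentSet] using fun _ _ _ => hxU, ?_⟩
    have h1 := segmentMoment_comp 0 (hU.prod isOpen_univ) hW hdf ((hx _).prodMk (hv _))
      ((htv _).prodMk zero) fun p hp s hs => ⟨hp s hs, trivial⟩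
    refine (h1.congr hW (fun p hp => hp.1) fun p hp =>
      (diffQuot_eq_segmentMoment hd hdf.continuousOn hp).symm).mono subset_rfl ?_
    rw [Set.singleton_subset_iff]
    exact ⟨by simpa [segmentSet] using fun _ _ _ => hxU, by simp⟩
  · have hW : IsOpen {p : E × E × 𝕜 | p ∈ diffQuotDomain 𝕜 U ∧ p.2.2 ≠ 0} :=
      (isOpen_diffQuotDomain hU).inter (isOpen_ne.preimage (by fun_prop))
    refine ⟨_, hW, ⟨⟨hxU, hxt⟩, ht0⟩, ?_⟩
    -- Composition with a smooth map is the case of constant segments.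
    have hcomp : ∀ {α : E × E × 𝕜 → E}, IsDirC (⊤ : Submodule 𝕜 E) n _
        {p : E × E × 𝕜 | p ∈ diffQuotDomain 𝕜 U ∧ p.2.2 ≠ 0}
        {p : E × E × 𝕜 | p ∈ diffQuotDomain 𝕜 U ∧ p.2.2 ≠ 0} α →
        (∀ p ∈ diffQuotDomain 𝕜 U, α p ∈ U) → IsDirC S n _
        {p : E × E × 𝕜 | p ∈ diffQuotDomain 𝕜 U ∧ p.2.2 ≠ 0} {(x, v, t)} fun p => f (α p) := by
      intro α hα hαU
      have h1 := segmentMoment_comp 0 hU hW hf hα zero fun p hp s _ => by simpa using hαU p hp.1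
      simp only [segmentMoment_zero_const] at h1
      exact h1.mono subset_rfl (Set.singleton_subset_iff.2 ⟨⟨⟨hxU, hxt⟩, ht0⟩, by simp⟩)
    have h1 := hcomp ((hx _).add (htv _)) fun p hp => hp.2
    have h2 := (hcomp (hx _) fun p hp => hp.1).clm_comp (T := S)
      (-ContinuousLinearMap.id 𝕜 _) fun y hy => S.neg_mem hy
    have h3 := (((ht {p | p ∈ diffQuotDomain 𝕜 U ∧ p.2.2 ≠ 0}).inv fun p hp => hp.2).mono subset_rfl
      (Set.singleton_subset_iff.2 ⟨⟨hxU, hxt⟩, ht0⟩)).smul (h1.add h2)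
    refine h3.congr hW (Set.singleton_subset_iff.2 ⟨⟨hxU, hxt⟩, ht0⟩) fun p hp => ?_
    change _ = diffQuot f df (p.1, p.2.1, p.2.2)
    rw [diffQuot_of_ne _ _ _ _ hp.2, sub_eq_add_neg]
    rfl

end IsDirC

/-! ### Embedding into a product of Banach spaces -/

section Embedding

variable {𝕜 : Type} [RCLike 𝕜] {F : Type*} [AddCommGroup F] [Module 𝕜 F]

/-- A copy of `F`, to carry the seminorm `p`. -/
def SeminormSpace (_ : Seminorm 𝕜 F) : Type _ := F

namespace SeminormSpace

variable (p : Seminorm 𝕜 F)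

noncomputable instance : SeminormedAddCommGroup (SeminormSpace p) :=
  p.toAddGroupSeminorm.toSeminormedAddCommGroup

noncomputable instance : NormedSpace 𝕜 (SeminormSpace p) where
  toModule := (inferInstance : Module 𝕜 F)
  norm_smul_le a x := (map_smul_eq_mul p a x).le

/-- The canonical linear map from `F` to the Banach space obtained from the seminorm `p` by
separation and completion. -/
noncomputable def toCompletion : F →ₗ[𝕜] UniformSpace.Completion (SeminormSpace p) where
  toFun x := UniformSpace.Completion.coe' (α := SeminormSpace p) x
  map_add' x y := UniformSpace.Completion.coe_add (α := SeminormSpace p) x y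
  map_smul' c x := UniformSpace.Completion.coe_smul (X := SeminormSpace p) c x

end SeminormSpace

/-- A space whose topology is given by seminorms embeds into a product of Banach spaces. -/
theorem WithSeminorms.isInducing_toCompletion [TopologicalSpace F] [IsTopologicalAddGroup F]
    {I : Type*} {p : SeminormFamily 𝕜 F I} (hp : WithSeminorms p) :
    IsInducing (LinearMap.pi fun i => SeminormSpace.toCompletion (p i)) := by
  refine ⟨?_⟩
  rw [p.withSeminorms_iff_topologicalSpace_eq_iInf.1 hp, Pi.topologicalSpace, induced_iInf]
  refine iInf_congr fun i => ?_
  rw [induced_compose]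
  exact (UniformSpace.Completion.isUniformInducing_coe (SeminormSpace (p i))).isInducing.eq_induced

open scoped ComplexOrder in
theorem LocallyConvexSpace.of_real [TopologicalSpace F] [IsTopologicalAddGroup F]
    [Module ℝ F] [IsScalarTower ℝ 𝕜 F] [LocallyConvexSpace ℝ F] : LocallyConvexSpace 𝕜 F :=
  LocallyConvexSpace.ofBasisZero 𝕜 F id (fun s => s ∈ 𝓝 0 ∧ Convex ℝ s)
    (LocallyConvexSpace.convex_basis_zero ℝ F)
    fun _ hs => convex_of_nonneg_surjective_algebraMap _
      (fun _ => RCLike.nonneg_iff_exists_ofReal.mp) hs.2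

end Embedding

/-! ### Locally convex targets -/

section LocallyConvex

variable {𝕜 : Type} [RCLike 𝕜]
  {F : Type*} [AddCommGroup F] [Module 𝕜 F] [TopologicalSpace F]
  [IsTopologicalAddGroup F] [ContinuousSMul 𝕜 F]
  [Module ℝ F] [IsScalarTower ℝ 𝕜 F] [LocallyConvexSpace ℝ F]

/-- For maps into a locally convex space, which need not be complete, the difference quotient map
of a map of order `n + 1` is of order `n`. -/
theorem IsDirC.diffQuot_of_locallyConvex {n : ℕ} {E : Type u} [AddCommGroup E] [Module 𝕜 E]
    [TopologicalSpace E] [IsTopologicalAddGroup E] [ContinuousSMul 𝕜 E] {U : Set E}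
    (hU : IsOpen U) {f : E → F} {df : E × E → F} (hf : IsDirC (⊤ : Submodule 𝕜 F) n E U U f)
    (hd : ∀ x ∈ U, ∀ v, HasDirDeriv 𝕜 f v x (df (x, v)))
    (hdf : IsDirC (⊤ : Submodule 𝕜 F) n (E × E) (U ×ˢ Set.univ) (U ×ˢ Set.univ) df) :
    IsDirC (⊤ : Submodule 𝕜 F) n (E × E × 𝕜) (diffQuotDomain 𝕜 U) (diffQuotDomain 𝕜 U)
      (diffQuot f df) := by
  have : ContinuousSMul ℝ F := IsScalarTower.continuousSMul 𝕜
  open scoped ComplexOrder in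
  have := LocallyConvexSpace.of_real (𝕜 := 𝕜) (F := F)
  have hind := (with_gaugeSeminormFamily (𝕜 := 𝕜) (E := F)).isInducing_toCompletion
  set ι : F →L[𝕜] _ := ⟨_, hind.continuous⟩
  let _ : ∀ i, NormedSpace ℝ
      (UniformSpace.Completion (SeminormSpace (gaugeSeminormFamily 𝕜 F i))) :=
    fun i => NormedSpace.restrictScalars ℝ 𝕜 _
  refine of_isInducing_comp (ι := ι) hind (isOpen_diffQuotDomain hU) ?_
  have h := diffQuot_of_pi hU (hf.clm_comp (T := ι.range) ι fun y _ => ⟨y, rfl⟩)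
    (fun x hx v => (hd x hx v).clm_comp ι) (hdf.clm_comp (T := ι.range) ι fun y _ => ⟨y, rfl⟩)
  convert h using 2 with p
  simp only [diffQuot]
  split_ifs <;> simp

/-- Existence and continuity of the directional derivatives already makes them additive in the
direction. -/
theorem map_add_of_hasDirDeriv [T2Space F] {E : Type*} [AddCommGroup E] [Module 𝕜 E]
    [TopologicalSpace E] [IsTopologicalAddGroup E] [ContinuousSMul 𝕜 E] {U : Set E}
    (hU : IsOpen U) {f : E → F} {df : E × E → F} (hf : ContinuousOn f U)
    (hd : ∀ x ∈ U, ∀ v, HasDirDeriv 𝕜 f v x (df (x, v)))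
    (hdf : ContinuousOn df (U ×ˢ Set.univ)) {x : E} (hx : x ∈ U) (v w : E) :
    df (x, v + w) = df (x, v) + df (x, w) :=
  map_add_of_continuousOn_diffQuot hU hd
    (IsDirC.diffQuot_of_locallyConvex (n := 0) hU ⟨hf, fun _ _ => trivial⟩ hd
      ⟨hdf, fun _ _ => trivial⟩).continuousOn hx v w

end LocallyConvex

/-! ### Classes defined by difference quotient maps -/

section ClassC

variable {𝕜 : Type} [RCLike 𝕜]
  {F : Type*} [AddCommGroup F] [Module 𝕜 F] [TopologicalSpace F]

/-- Needed to restrict `f^[1]` to the points `(x, v, 0)`. -/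
theorem IsClassCNat.comp_clm {n : ℕ} : ∀ {E E' : Type u} [AddCommGroup E] [Module 𝕜 E]
    [TopologicalSpace E] [AddCommGroup E'] [Module 𝕜 E'] [TopologicalSpace E']
    {U : Set E} {f : E → F}, IsClassCNat 𝕜 n E U f → ∀ L : E' →L[𝕜] E,
    IsClassCNat 𝕜 n E' (L ⁻¹' U) (fun x => f (L x)) := by
  induction n with
  | zero =>
    intro E E' _ _ _ _ _ _ U f h L
    exact ContinuousOn.comp h L.continuous.continuousOn (Set.mapsTo_preimage L U)
  | succ n ih =>
    rintro E E' _ _ _ _ _ _ U f ⟨hc, g, ⟨hgc, hg⟩, hgn⟩ L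
    let M := L.prodMap (L.prodMap (ContinuousLinearMap.id 𝕜 𝕜))
    have hM : diffQuotDomain 𝕜 (L ⁻¹' U) = M ⁻¹' diffQuotDomain 𝕜 U := by
      ext p
      simp [diffQuotDomain, M]
    refine ⟨hc.comp L.continuous.continuousOn (Set.mapsTo_preimage L U), fun p => g (M p),
      ⟨?_, fun x v t hp => ?_⟩, ?_⟩
    · rw [hM]
      exact hgc.comp M.continuous.continuousOn (Set.mapsTo_preimage M _)
    · rw [hM] at hp
      simpa [M] using hg (L x) (L v) t hp
    · rw [hM]
      exact ih hgn M

theorem IsDiffQuotMap.hasDirDeriv {E : Type*} [AddCommGroup E] [Module 𝕜 E]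
    [TopologicalSpace E] [IsTopologicalAddGroup E] [ContinuousSMul 𝕜 E] {U : Set E}
    (hU : IsOpen U) {f : E → F} {g : E × E × 𝕜 → F} (h : IsDiffQuotMap 𝕜 U f g)
    {x : E} (hx : x ∈ U) (v : E) : HasDirDeriv 𝕜 f v x (g (x, v, 0)) := by
  have hmem : ((x, v, 0) : E × E × 𝕜) ∈ diffQuotDomain 𝕜 U := by simpa [diffQuotDomain]
  have h1 := (h.1.continuousAt ((isOpen_diffQuotDomain hU).mem_nhds hmem)).tendsto
  have h2 : Tendsto (fun t : 𝕜 => (x, v, t)) (𝓝[≠] 0) (𝓝 (x, v, 0)) :=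
    tendsto_const_nhds.prodMk_nhds (tendsto_const_nhds.prodMk_nhds nhdsWithin_le_nhds)
  refine Tendsto.congr' ?_ (h1.comp h2)
  filter_upwards [self_mem_nhdsWithin,
    (tendsto_add_smul_zero x v).eventually (hU.mem_nhds hx)] with t ht htU
  rw [h.2 x v t ⟨hx, htU⟩, inv_smul_smul₀ ht, Function.comp]

theorem IsClassCNat.isDirC {n : ℕ} : ∀ {E : Type u} [AddCommGroup E] [Module 𝕜 E]
    [TopologicalSpace E] [IsTopologicalAddGroup E] [ContinuousSMul 𝕜 E] {U : Set E} {f : E → F},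
    IsOpen U → IsClassCNat 𝕜 n E U f → IsDirC (⊤ : Submodule 𝕜 F) n E U U f := by
  induction n with
  | zero => exact fun _ h => ⟨h, fun _ _ => trivial⟩
  | succ n ih =>
    rintro E _ _ _ _ _ U f hU ⟨hc, g, hg, hgn⟩
    refine ⟨hc, fun _ _ => trivial, fun p => g (p.1, p.2, 0),
      fun x hx v => hg.hasDirDeriv hU hx v, ih (hU.prod isOpen_univ) ?_⟩
    have h := hgn.comp_clm ((ContinuousLinearMap.fst 𝕜 E E).prod
      ((ContinuousLinearMap.snd 𝕜 E E).prod 0))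
    convert h using 1
    · ext p
      simp [diffQuotDomain]
    · rfl

variable [IsTopologicalAddGroup F] [ContinuousSMul 𝕜 F]
  [Module ℝ F] [IsScalarTower ℝ 𝕜 F] [LocallyConvexSpace ℝ F]

/-- `f^[1]` has one order less than `f` but again satisfies `IsDirC`, so the recursion that defines
`IsClassCNat` can be followed. -/
theorem IsDirC.isClassCNat {n : ℕ} : ∀ {E : Type u} [AddCommGroup E] [Module 𝕜 E]
    [TopologicalSpace E] [IsTopologicalAddGroup E] [ContinuousSMul 𝕜 E] {U : Set E} {f : E → F},
    IsOpen U → IsDirC (⊤ : Submodule 𝕜 F) n E U U f → IsClassCNat 𝕜 n E U f := by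
  induction n with
  | zero => exact fun _ h => h.1
  | succ n ih =>
    intro E _ _ _ _ _ U f hU hf
    have hf' := hf.of_succ
    obtain ⟨hc, -, df, hd, hdf⟩ := hf
    have hg := hf'.diffQuot_of_locallyConvex hU hd hdf
    exact ⟨hc, diffQuot f df,
      ⟨hg.continuousOn, fun x v t _ => (smul_diffQuot f df x v t).symm⟩,
      ih (isOpen_diffQuotDomain hU) hg⟩

theorem isClassCNat_iff_isDirC {n : ℕ} {E : Type*} [AddCommGroup E] [Module 𝕜 E]
    [TopologicalSpace E] [IsTopologicalAddGroup E] [ContinuousSMul 𝕜 E] {U : Set E} (hU : IsOpen U)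
    {f : E → F} : IsClassCNat 𝕜 n E U f ↔ IsDirC (⊤ : Submodule 𝕜 F) n E U U f :=
  ⟨fun h => h.isDirC hU, fun h => h.isClassCNat hU⟩

end ClassC

section MichalBastiani

/-! ### Michal–Bastiani maps -/

/-- Directional derivatives in the first variable are partial derivatives. -/
theorem HasDirDeriv.of_prod {𝕜 : Type} [RCLike 𝕜] {E P F : Type*} [AddCommGroup E] [Module 𝕜 E]
    [AddCommGroup F] [Module 𝕜 F] [TopologicalSpace F] [AddCommGroup P] [Module 𝕜 P]
    {g : E × P → F} {x v : E} {w : P} {y : F} (h : HasDirDeriv 𝕜 g (v, 0) (x, w) y) :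
    HasDirDeriv 𝕜 (fun x => g (x, w)) v x y := by
  refine h.congr fun t => ?_
  simp

variable {𝕜 : Type} [RCLike 𝕜]
  {E : Type u} [AddCommGroup E] [Module 𝕜 E] [TopologicalSpace E]
  [IsTopologicalAddGroup E] [ContinuousSMul 𝕜 E]
  {F : Type*} [AddCommGroup F] [Module 𝕜 F] [TopologicalSpace F] [T2Space F]
  {U : Set E} {f : E → F}

/-- The iterated directional derivative `d^j f` is obtained from the `j`-th derivative of `f`, taken
with respect to points and directions, by a linear substitution. -/
theorem IsDirC.uncurry_iterDirDeriv (hU : IsOpen U) (j : ℕ) : ∀ {m : ℕ},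
    IsDirC (⊤ : Submodule 𝕜 F) (m + j) E U U f →
    IsDirC (⊤ : Submodule 𝕜 F) m (E × (Fin j → E)) (U ×ˢ Set.univ) (U ×ˢ Set.univ)
      (fun p => iterDirDeriv 𝕜 f j p.2 p.1) := by
  induction j with
  | zero =>
    intro m h
    exact (h.comp_clm (ContinuousLinearMap.fst 𝕜 E (Fin 0 → E))).mono
      (fun _ hp => hp.1) (fun _ hp => hp.1)
  | succ j ih =>
    intro m h
    rw [show m + (j + 1) = m + 1 + j by ring] at h
    obtain ⟨-, -, d, hd, hdm⟩ := ih h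
    let T : (Fin (j + 1) → E) →L[𝕜] (Fin j → E) :=
      ContinuousLinearMap.pi fun i => ContinuousLinearMap.proj i.succ
    let p₁ := ContinuousLinearMap.fst 𝕜 E (Fin (j + 1) → E)
    let p₂ := ContinuousLinearMap.snd 𝕜 E (Fin (j + 1) → E)
    let L : E × (Fin (j + 1) → E) →L[𝕜] (E × (Fin j → E)) × (E × (Fin j → E)) :=
      (p₁.prod (T.comp p₂)).prod (((ContinuousLinearMap.proj 0).comp p₂).prod 0)
    have h1 := (hdm.comp_clm L).mono (U' := U ×ˢ Set.univ) (Z' := U ×ˢ Set.univ)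
      (fun p hp => ⟨⟨hp.1, trivial⟩, trivial⟩) (fun p hp => ⟨⟨hp.1, trivial⟩, trivial⟩)
    refine h1.congr (hU.prod isOpen_univ) subset_rfl fun p hp => ?_
    exact (HasDirDeriv.of_prod (hd (p.1, Fin.tail p.2) ⟨hp.1, trivial⟩ (p.2 0, 0))).dirDeriv_eq.symm

variable (𝕜 U f) in
/-- The iterated directional derivatives of `f` up to order `n` exist and are continuous on `U`. -/
structure HasContIterDirDeriv (n : ℕ) : Prop where
  exists_hasDirDeriv : ∀ j < n, ∀ x ∈ U, ∀ v : Fin (j + 1) → E,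
    ∃ y, HasDirDeriv 𝕜 (iterDirDeriv 𝕜 f j (Fin.tail v)) (v 0) x y
  continuousOn : ∀ j ≤ n,
    ContinuousOn (fun p : E × (Fin j → E) => iterDirDeriv 𝕜 f j p.2 p.1) (U ×ˢ Set.univ)

namespace HasContIterDirDeriv

omit [IsTopologicalAddGroup E] [ContinuousSMul 𝕜 E] [T2Space F] in
theorem hasDirDeriv {n j : ℕ} (h : HasContIterDirDeriv 𝕜 U f n) (hj : j < n) {x : E} (hx : x ∈ U)
    (v : Fin j → E) (y : E) :
    HasDirDeriv 𝕜 (iterDirDeriv 𝕜 f j v) y x (iterDirDeriv 𝕜 f (j + 1) (Fin.cons y v) x) := by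
  have := hasDirDeriv_dirDeriv (h.exists_hasDirDeriv j hj x hx (Fin.cons y v))
  simpa [iterDirDeriv] using this

variable [IsTopologicalAddGroup F] [ContinuousSMul 𝕜 F]
  [Module ℝ F] [IsScalarTower ℝ 𝕜 F] [LocallyConvexSpace ℝ F]

theorem map_update_add {n : ℕ} (hU : IsOpen U) (h : HasContIterDirDeriv 𝕜 U f n) (j : ℕ)
    (hj : j ≤ n) : ∀ x ∈ U, ∀ (v : Fin j → E) (i : Fin j) (a b : E),
    iterDirDeriv 𝕜 f j (Function.update v i (a + b)) x =
      iterDirDeriv 𝕜 f j (Function.update v i a) x +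
        iterDirDeriv 𝕜 f j (Function.update v i b) x := by
  induction j with
  | zero => exact fun _ _ _ i => i.elim0
  | succ j ih =>
    intro x hx v i a b
    rw [← Fin.cons_self_tail v]
    generalize v 0 = y
    generalize Fin.tail v = w
    cases i using Fin.cases with
    | zero =>
      simp only [Fin.update_cons_zero]
      refine map_add_of_hasDirDeriv hU (f := iterDirDeriv 𝕜 f j w)
        (df := fun p => iterDirDeriv 𝕜 f (j + 1) (Fin.cons p.2 w) p.1) ?_
        (fun x hx v => h.hasDirDeriv hj hx w v) ?_ hx a b
      · exact (h.continuousOn j (Nat.le_of_succ_le hj)).comp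
          (by fun_prop : Continuous fun x : E => (x, w)).continuousOn fun x hx => ⟨hx, trivial⟩
      · exact (h.continuousOn (j + 1) hj).comp
          (f := fun p : E × E => (p.1, (Fin.cons p.2 w : Fin (j + 1) → E)))
          (by fun_prop) fun x hx => ⟨hx.1, trivial⟩
    | succ i =>
      -- Additivity in this slot holds on all of `U` one order lower, so it can be differentiated.
      simp only [← Fin.cons_update]
      refine (h.hasDirDeriv hj hx _ y).unique (((h.hasDirDeriv hj hx _ y).add
        (h.hasDirDeriv hj hx _ y)).congr_of_eqOn hU hx fun z hz => ?_)
      exact (ih (Nat.le_of_succ_le hj) z hz w i a b).symm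

omit [Module ℝ F] [IsScalarTower ℝ 𝕜 F] [LocallyConvexSpace ℝ F] in
theorem map_update_smul {n : ℕ} (hU : IsOpen U) (h : HasContIterDirDeriv 𝕜 U f n) (j : ℕ)
    (hj : j ≤ n) : ∀ x ∈ U, ∀ (v : Fin j → E) (i : Fin j) (c : 𝕜) (a : E),
    iterDirDeriv 𝕜 f j (Function.update v i (c • a)) x =
      c • iterDirDeriv 𝕜 f j (Function.update v i a) x := by
  induction j with
  | zero => exact fun _ _ _ i => i.elim0
  | succ j ih =>
    intro x hx v i c a
    rw [← Fin.cons_self_tail v]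
    generalize v 0 = y
    generalize Fin.tail v = w
    cases i using Fin.cases with
    | zero =>
      simp only [Fin.update_cons_zero]
      exact (h.hasDirDeriv hj hx w (c • a)).unique ((h.hasDirDeriv hj hx w a).smul_dir c)
    | succ i =>
      simp only [← Fin.cons_update]
      refine (h.hasDirDeriv hj hx _ y).unique (((h.hasDirDeriv hj hx _ y).clm_comp
        (c • ContinuousLinearMap.id 𝕜 F)).congr_of_eqOn hU hx fun z hz => ?_)
      exact (ih (Nat.le_of_succ_le hj) z hz w i c a).symm

/-- Multilinear expansion of `d^j f (x, v + t w)` in powers of `t`. -/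
theorem map_add_smul {n : ℕ} (hU : IsOpen U) (h : HasContIterDirDeriv 𝕜 U f n) {j : ℕ}
    (hj : j ≤ n) {x : E} (hx : x ∈ U) (v w : Fin j → E) (t : 𝕜) :
    iterDirDeriv 𝕜 f j (v + t • w) x =
      ∑ s : Finset (Fin j), t ^ (sᶜ).card • iterDirDeriv 𝕜 f j (s.piecewise v w) x := by
  let Ψ : MultilinearMap 𝕜 (fun _ : Fin j => E) F :=
    MultilinearMap.mk' (fun v => iterDirDeriv 𝕜 f j v x)
      (h.map_update_add hU j hj x hx) (h.map_update_smul hU j hj x hx)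
  change Ψ (v + t • w) = ∑ s : Finset (Fin j), t ^ (sᶜ).card • Ψ (s.piecewise v w)
  rw [Ψ.map_add_univ]
  refine Finset.sum_congr rfl fun s _ => ?_
  have h1 := Ψ.map_piecewise_smul (fun _ => t) (s.piecewise v w) sᶜ
  rw [Finset.prod_const] at h1
  rw [← h1]
  congr 1
  ext i
  by_cases hi : i ∈ s <;> simp [hi]

/-- The derivative of `(x, v) ↦ d^j f (x, v)` in the direction `(y, w)`. Only the summands with one
entry of `v` replaced by an entry of `w` are nonzero, because of the powers of `0`. -/
theorem hasDirDeriv_uncurry {n : ℕ} (hU : IsOpen U) (h : HasContIterDirDeriv 𝕜 U f n) {j : ℕ}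
    (hj : j < n) {x : E} (hx : x ∈ U) (v w : Fin j → E) (y : E) :
    HasDirDeriv 𝕜 (fun p : E × (Fin j → E) => iterDirDeriv 𝕜 f j p.2 p.1) (y, w) (x, v)
      (iterDirDeriv 𝕜 f (j + 1) (Fin.cons y v) x +
        ∑ s ∈ Finset.univ.erase Finset.univ,
          (0 : 𝕜) ^ ((sᶜ : Finset (Fin j)).card - 1) •
            iterDirDeriv 𝕜 f j (s.piecewise v w) x) := by
  have h1 : ∀ s : Finset (Fin j), Tendsto
      (fun t : 𝕜 => t ^ ((sᶜ : Finset (Fin j)).card - 1) •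
        iterDirDeriv 𝕜 f j (s.piecewise v w) (x + t • y)) (𝓝[≠] 0)
      (𝓝 ((0 : 𝕜) ^ ((sᶜ : Finset (Fin j)).card - 1) •
        iterDirDeriv 𝕜 f j (s.piecewise v w) x)) := by
    intro s
    refine Tendsto.smul ?_ ?_
    · exact ((continuous_pow _).tendsto 0).mono_left nhdsWithin_le_nhds
    · have h2 := ((h.continuousOn j hj.le).continuousAt
        ((hU.prod isOpen_univ).mem_nhds (Set.mk_mem_prod hx (Set.mem_univ (s.piecewise v w))))).tendsto
      exact h2.comp ((tendsto_add_smul_zero x y).prodMk_nhds tendsto_const_nhds)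
  refine Tendsto.congr' ?_ (Tendsto.add (h.hasDirDeriv hj hx v y)
    (tendsto_finsetSum _ fun s _ => h1 s))
  filter_upwards [self_mem_nhdsWithin,
    (tendsto_add_smul_zero x y).eventually (hU.mem_nhds hx)] with t ht htU
  simp only [Prod.smul_mk, Prod.mk_add_mk]
  rw [h.map_add_smul hU hj.le htU, ← Finset.add_sum_erase _ _ (Finset.mem_univ Finset.univ)]
  simp only [Finset.compl_univ, Finset.card_empty, pow_zero, one_smul, Finset.piecewise_univ]
  rw [add_sub_right_comm, smul_add, Finset.smul_sum]
  congr 1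
  refine Finset.sum_congr rfl fun s hs => ?_
  have hs' : (sᶜ : Finset (Fin j)).card ≠ 0 := by
    simpa [Finset.compl_eq_empty_iff] using Finset.ne_of_mem_erase hs
  rw [smul_smul]
  congr 1
  rw [eq_inv_mul_iff_mul_eq₀ ht, mul_pow_sub_one hs']

/-- By multilinearity, the derivative of `d^j f` with respect to points and directions is a sum of
terms `d^(j+1) f` and `d^j f` with linearly substituted arguments, so that all of its derivatives
exist as long as `d^(j+1) f`, `d^(j+2) f`, … do. -/
theorem isDirC_iterDirDeriv {n : ℕ} (hU : IsOpen U) (h : HasContIterDirDeriv 𝕜 U f n) (m : ℕ) :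
    ∀ {j : ℕ}, m + j ≤ n →
    IsDirC (⊤ : Submodule 𝕜 F) m (E × (Fin j → E)) (U ×ˢ Set.univ) (U ×ˢ Set.univ)
      (fun p => iterDirDeriv 𝕜 f j p.2 p.1) := by
  induction m with
  | zero => exact fun hj => ⟨h.continuousOn _ (by lia), fun _ _ => trivial⟩
  | succ m ih =>
    intro j hj
    let V := Fin j → E
    let x : (E × V) × (E × V) →L[𝕜] E :=
      (ContinuousLinearMap.fst 𝕜 E V).comp (ContinuousLinearMap.fst 𝕜 _ _)
    let v : (E × V) × (E × V) →L[𝕜] V :=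
      (ContinuousLinearMap.snd 𝕜 E V).comp (ContinuousLinearMap.fst 𝕜 _ _)
    let y : (E × V) × (E × V) →L[𝕜] E :=
      (ContinuousLinearMap.fst 𝕜 E V).comp (ContinuousLinearMap.snd 𝕜 _ _)
    let w : (E × V) × (E × V) →L[𝕜] V :=
      (ContinuousLinearMap.snd 𝕜 E V).comp (ContinuousLinearMap.snd 𝕜 _ _)
    refine ⟨h.continuousOn _ (by lia), fun _ _ => trivial, fun p =>
      iterDirDeriv 𝕜 f (j + 1) (Fin.cons (y p) (v p)) (x p) +
        ∑ s ∈ Finset.univ.erase Finset.univ,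
          (0 : 𝕜) ^ ((sᶜ : Finset (Fin j)).card - 1) •
            iterDirDeriv 𝕜 f j (s.piecewise (v p) (w p)) (x p),
      fun p hp q => h.hasDirDeriv_uncurry hU (by lia) hp.1 p.2 q.2 q.1, ?_⟩
    refine IsDirC.add ?_ (IsDirC.sum _ fun s _ => ?_)
    · let L : (E × V) × (E × V) →L[𝕜] E × (Fin (j + 1) → E) :=
        x.prod (ContinuousLinearMap.pi
          (Fin.cons y fun i => (ContinuousLinearMap.proj i).comp v))
      have hL : ∀ p, L p = (x p, Fin.cons (y p) (v p)) := by
        intro p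
        refine Prod.ext rfl (funext fun i => ?_)
        cases i using Fin.cases <;> rfl
      have h1 := (ih (j := j + 1) (by lia)).comp_clm L
      simp only [hL] at h1
      exact h1.mono (fun p hp => ⟨hp.1.1, trivial⟩) (fun p hp => ⟨hp.1.1, trivial⟩)
    · let L : (E × V) × (E × V) →L[𝕜] E × (Fin j → E) :=
        x.prod (ContinuousLinearMap.pi
          (s.piecewise (fun i => (ContinuousLinearMap.proj i).comp v)
            fun i => (ContinuousLinearMap.proj i).comp w))
      have hL : ∀ p, L p = (x p, s.piecewise (v p) (w p)) := by
        intro p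
        refine Prod.ext rfl (funext fun i => ?_)
        by_cases hi : i ∈ s <;> simp [L, hi]
      have h1 := ((ih (j := j) (by lia)).comp_clm L).clm_comp (T := ⊤)
        ((0 : 𝕜) ^ ((sᶜ : Finset (Fin j)).card - 1) • ContinuousLinearMap.id 𝕜 F)
        fun _ _ => trivial
      simp only [hL] at h1
      exact h1.mono (fun p hp => ⟨hp.1.1, trivial⟩) (fun p hp => ⟨hp.1.1, trivial⟩)

end HasContIterDirDeriv

theorem isDirC_iff_hasContIterDirDeriv [IsTopologicalAddGroup F] [ContinuousSMul 𝕜 F]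
    [Module ℝ F] [IsScalarTower ℝ 𝕜 F] [LocallyConvexSpace ℝ F] {n : ℕ} (hU : IsOpen U) :
    IsDirC (⊤ : Submodule 𝕜 F) n E U U f ↔ HasContIterDirDeriv 𝕜 U f n := by
  refine ⟨fun h => ⟨fun j hj x hx v => ?_, fun j hj => ?_⟩, fun h => ?_⟩
  · obtain ⟨-, -, d, hd, -⟩ := (h.of_le (m := 1 + j) (by lia)).uncurry_iterDirDeriv hU j
    exact ⟨_, HasDirDeriv.of_prod (hd (x, Fin.tail v) ⟨hx, trivial⟩ (v 0, 0))⟩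
  · exact ((h.of_le (m := 0 + j) (by lia)).uncurry_iterDirDeriv hU j).continuousOn
  · have h1 := (h.isDirC_iterDirDeriv hU n (j := 0) le_rfl).comp_clm
      (ContinuousLinearMap.inl 𝕜 E (Fin 0 → E))
    exact h1.mono (fun x hx => ⟨hx, trivial⟩) (fun x hx => ⟨hx, trivial⟩)

omit [IsTopologicalAddGroup E] [ContinuousSMul 𝕜 E] [T2Space F] in
theorem isClassCMB_iff (k : ℕ∞) :
    IsClassCMB 𝕜 k U f ↔ ∀ n : ℕ, (n : ℕ∞) ≤ k → HasContIterDirDeriv 𝕜 U f n := by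
  constructor
  · rintro ⟨hc, h⟩ n hn
    refine ⟨fun j hj => (h j (le_trans (by exact_mod_cast hj) hn)).1, fun j hj => ?_⟩
    cases j with
    | zero => exact hc.comp continuous_fst.continuousOn fun _ hp => hp.1
    | succ j => exact (h j (le_trans (by exact_mod_cast hj) hn)).2
  · refine fun h => ⟨?_, fun i hi => ⟨(h (i + 1) hi).exists_hasDirDeriv i (Nat.lt_succ_self i),
      (h (i + 1) hi).continuousOn (i + 1) le_rfl⟩⟩
    exact ((h 0 (by simp)).continuousOn 0 le_rfl).comp
      (by fun_prop : Continuous fun x : E => (x, (0 : Fin 0 → E))).continuousOn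
      fun x hx => ⟨hx, trivial⟩

end MichalBastiani

theorem proposition7p4 {𝕜 : Type} [RCLike 𝕜] {E F : Type*}
    [AddCommGroup E] [Module 𝕜 E] [TopologicalSpace E]
    [IsTopologicalAddGroup E] [ContinuousSMul 𝕜 E] [T2Space E]
    [AddCommGroup F] [Module 𝕜 F] [TopologicalSpace F]
    [IsTopologicalAddGroup F] [ContinuousSMul 𝕜 F] [T2Space F]
    [Module ℝ F] [IsScalarTower ℝ 𝕜 F] [LocallyConvexSpace ℝ F]
    (k : ℕ∞) {U : Set E} (hU : IsOpen U) (f : E → F) :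
    IsClassC 𝕜 k U f ↔ IsClassCMB 𝕜 k U f := by
  rw [isClassCMB_iff]
  exact forall₂_congr fun n _ =>
    (isClassCNat_iff_isDirC hU).trans (isDirC_iff_hasContIterDirDeriv hU)
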